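/- Let $U\subset\mathbb R^2$ be a bounded domain of class $C^2$, let $T,\varepsilon,\eta>0$, $g\in L^2(U)$ and $u_0,z_0\in H^1(U)$ with $0\le z_0\le 1$ a.e. in $U$. Let $\phi:\mathbb R\to\mathbb R$ be a $C^\infty$ nondecreasing function with $\phi(s)=-1$ for $s\le -1$, $\phi(s)=s$ for $0<s<1$ and $\phi(s)=2$ for $s\ge 2$. For continuous functions $a,b:\mathbb R\to\mathbb R$ consider the system $$\begin{cases}\partial_t u=\operatorname{div}\big((\eta+a(z))\nabla u\big)-(u-g) & \text{in }(0,T)\times U,\\ \partial_t z=2\varepsilon\Delta z-b(z)|\nabla u|^2+\dfrac{1-z}{2\varepsilon} & \text{in }(0,T)\times U,\\ \partial_n u=\partial_n z=0 & \text{on }(0,T)\times\partial U,\\ u(0,\cdot)=u_0,\quad z(0,\cdot)=z_0 & \text{in }U.\end{cases}\tag{S$_{a,b}$}$$ A strong solution of (S$_{a,b}$) is a pair $(u,z)\in[L^2(0,T;H^2(U))\cap L^\infty(0,T;H^1(U))\cap H^1(0,T;L^2(U))]^2$ such that 1. for every $\xi\in C_c^\infty(U)$ the integrals below exist, and for a.e.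 $t\in(0,T)$ and all $\xi\in C_c^\infty(U)$, $$\int_U u(t)\xi\,dx=\int_U u_0\xi\,dx-\int_0^t\!\!\int_U(\eta+a(z))\nabla u\cdot\nabla\xi\,dx\,ds-\int_0^t\!\!\int_U(u-g)\xi\,dx\,ds,$$ $$\int_U z(t)\xi\,dx=\int_U z_0\xi\,dx-\int_0^t\!\!\int_U 2\varepsilon\nabla z\cdot\nabla\xi\,dx\,ds-\int_0^t\!\!\int_U b(z)|\nabla u|^2\xi\,dx\,ds+\int_0^t\!\!\int_U\frac{1-z}{2\varepsilon}\xi\,dx\,ds;$$ 2. $\partial_n u(t)=\partial_n z(t)=0$ on $\partial U$ for a.e. $t\in(0,T)$, where for $v\in H^2(U)$ the condition $\partial_n v=0$ means $\int_U\nabla v\cdot\nabla\psi\,dx+\int_U\Delta v\,\psi\,dx=0$ for all $\psi\in H^1(U)$. Let $(u,z)$ be a strong solution of the cut-off system, that is, of (S$_{a,b}$) with $a=\phi^2$ and $b=\phi'\phi$. Then $z$ has a representative in $C([0,T];L^2(U))$, again denoted by $z$, and for every $t\in(0,T)$ $$0\le z(t,x)\le 1\quad\text{for a.e. }x\in U.$$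 Moreover, $(u,z)$ is a strong solution of the original system, that is, of (S$_{a,b}$) with $a(s)=s^2$ and $b(s)=s$. -/

import Mathlib

open MeasureTheory Set
open scoped ContDiff ENNReal

noncomputable section

namespace AmbrosioTortorelli

/-- The Euclidean plane. -/
abbrev Plane : Type := EuclideanSpace ℝ (Fin 2)

/-- `L²(U)`, real valued, with respect to Lebesgue measure. -/
abbrev L2 (U : Set Plane) : Type := Lp ℝ 2 ((volume : Measure Plane).restrict U)

/-- A bounded domain (open connected nonempty set) of class `C²`: near each boundary point `p`,
`U` is the sublevel set `{ρ < 0}` of a `C²` function `ρ` whose differential at `p` is nonzero. -/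
structure IsBoundedC2Domain (U : Set Plane) : Prop where
  isOpen : IsOpen U
  isConnected : IsConnected U
  isBounded : Bornology.IsBounded U
  boundary : ∀ p ∈ frontier U, ∃ (V : Set Plane) (ρ : Plane → ℝ),
    IsOpen V ∧ p ∈ V ∧ ContDiffOn ℝ 2 ρ V ∧ fderiv ℝ ρ p ≠ 0 ∧ U ∩ V = {x ∈ V | ρ x < 0}

/-- `ξ ∈ C_c^∞(U)`. -/
structure IsTestFunction (U : Set Plane) (ξ : Plane → ℝ) : Prop where
  smooth : ContDiff ℝ ∞ ξ
  hasCompactSupport : HasCompactSupport ξ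
  tsupport_subset : tsupport ξ ⊆ U

/-- The classical partial derivative `∂ᵢ ξ (x)`. -/
def pd (i : Fin 2) (ξ : Plane → ℝ) (x : Plane) : ℝ :=
  fderiv ℝ ξ x (EuclideanSpace.single i 1)

/-- `h ∈ L²(U)` is the weak `i`-th partial derivative of `f ∈ L²(U)` in `U`. -/
def HasWeakPartial (U : Set Plane) (i : Fin 2) (f h : L2 U) : Prop :=
  ∀ ξ : Plane → ℝ, IsTestFunction U ξ →
    ∫ x in U, f x * pd i ξ x = - ∫ x in U, h x * ξ x

theorem IsTestFunction.memLp {U : Set Plane} {ξ : Plane → ℝ} (hξ : IsTestFunction U ξ) :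
    MemLp ξ 2 ((volume : Measure Plane).restrict U) :=
  (hξ.smooth.continuous.memLp_of_hasCompactSupport hξ.hasCompactSupport).restrict U

theorem IsTestFunction.memLp_pd {U : Set Plane} {ξ : Plane → ℝ} (hξ : IsTestFunction U ξ)
    (i : Fin 2) : MemLp (pd i ξ) 2 ((volume : Measure Plane).restrict U) := by
  have hc : Continuous (pd i ξ) :=
    (hξ.smooth.continuous_fderiv (by simp)).clm_apply continuous_const
  exact (hc.memLp_of_hasCompactSupport
    (hξ.hasCompactSupport.fderiv_apply (𝕜 := ℝ) _)).restrict U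

theorem integrable_L2_mul {U : Set Plane} (f : L2 U) {k : Plane → ℝ}
    (hk : MemLp k 2 ((volume : Measure Plane).restrict U)) :
    Integrable (fun x => f x * k x) ((volume : Measure Plane).restrict U) :=
  (Lp.memLp f).integrable_mul hk

theorem integral_L2_zero_mul {U : Set Plane} (k : Plane → ℝ) :
    ∫ x in U, (0 : L2 U) x * k x = 0 := by
  rw [← integral_zero Plane ℝ (μ := (volume : Measure Plane).restrict U)]
  refine integral_congr_ae ?_
  filter_upwards [Lp.coeFn_zero ℝ 2 ((volume : Measure Plane).restrict U)] with x hx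
  rw [hx]
  simp

theorem integral_L2_add_mul {U : Set Plane} (f h : L2 U) {k : Plane → ℝ}
    (hk : MemLp k 2 ((volume : Measure Plane).restrict U)) :
    ∫ x in U, (f + h) x * k x = (∫ x in U, f x * k x) + ∫ x in U, h x * k x := by
  rw [← integral_add (integrable_L2_mul f hk) (integrable_L2_mul h hk)]
  refine integral_congr_ae ?_
  filter_upwards [Lp.coeFn_add f h] with x hx
  rw [hx]
  simp [add_mul]

theorem integral_L2_smul_mul {U : Set Plane} (c : ℝ) (f : L2 U) (k : Plane → ℝ) :
    ∫ x in U, (c • f) x * k x = c * ∫ x in U, f x * k x := by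
  rw [← integral_const_mul]
  refine integral_congr_ae ?_
  filter_upwards [Lp.coeFn_smul c f] with x hx
  rw [hx]
  simp [mul_assoc]

theorem HasWeakPartial.zero {U : Set Plane} (i : Fin 2) :
    HasWeakPartial U i (0 : L2 U) (0 : L2 U) := fun ξ _ => by
  rw [integral_L2_zero_mul, integral_L2_zero_mul, neg_zero]

theorem HasWeakPartial.add {U : Set Plane} {i : Fin 2} {f h f₁ h₁ : L2 U}
    (H : HasWeakPartial U i f h) (H₁ : HasWeakPartial U i f₁ h₁) :
    HasWeakPartial U i (f + f₁) (h + h₁) := fun ξ hξ => by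
  rw [integral_L2_add_mul _ _ (hξ.memLp_pd i), integral_L2_add_mul _ _ hξ.memLp, H ξ hξ,
    H₁ ξ hξ, neg_add]

theorem HasWeakPartial.smul {U : Set Plane} {i : Fin 2} {f h : L2 U} (c : ℝ)
    (H : HasWeakPartial U i f h) : HasWeakPartial U i (c • f) (c • h) := fun ξ hξ => by
  rw [integral_L2_smul_mul, integral_L2_smul_mul, H ξ hξ, mul_neg]

/-- The Sobolev space `H¹(U)`: a function of `L²(U)` together with its (unique) weak first
partial derivatives, all in `L²(U)`. The norm inherited from the product is equivalent to the
usual Hilbert norm of `H¹(U)`. -/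
def sobolevH1 (U : Set Plane) : Submodule ℝ (L2 U × (Fin 2 → L2 U)) where
  carrier := {p | ∀ i, HasWeakPartial U i p.1 (p.2 i)}
  zero_mem' := fun i => HasWeakPartial.zero i
  add_mem' := fun ha hb i => (ha i).add (hb i)
  smul_mem' := fun c _ ha i => (ha i).smul c

/-- The Sobolev space `H²(U)`: a function of `L²(U)` together with its (unique) weak first and
second partial derivatives, all in `L²(U)`. The norm inherited from the product is equivalent to
the usual Hilbert norm of `H²(U)`. -/
def sobolevH2 (U : Set Plane) :
    Submodule ℝ (L2 U × (Fin 2 → L2 U) × (Fin 2 → Fin 2 → L2 U)) where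
  carrier := {p | (∀ i, HasWeakPartial U i p.1 (p.2.1 i)) ∧
    ∀ i j, HasWeakPartial U j (p.2.1 i) (p.2.2 i j)}
  zero_mem' := ⟨fun i => HasWeakPartial.zero i, fun _ j => HasWeakPartial.zero j⟩
  add_mem' := fun ha hb =>
    ⟨fun i => (ha.1 i).add (hb.1 i), fun i j => (ha.2 i j).add (hb.2 i j)⟩
  smul_mem' := fun c _ ha => ⟨fun i => (ha.1 i).smul c, fun i j => (ha.2 i j).smul c⟩

/-- `H¹(U)` as a normed space. -/
abbrev H1 (U : Set Plane) : Type := ↥(sobolevH1 U)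

/-- `H²(U)` as a normed space. -/
abbrev H2 (U : Set Plane) : Type := ↥(sobolevH2 U)

section Solutions

variable {U : Set Plane}

/-- The underlying function of an element of `H¹(U)`. -/
def H1.fn (v : H1 U) : L2 U := v.1.1

/-- The weak partial derivative `∂ᵢ v` of `v ∈ H¹(U)`. -/
def H1.d (i : Fin 2) (v : H1 U) : L2 U := v.1.2 i

/-- The inclusion `H²(U) ⊆ H¹(U)`. -/
def H2.toH1 (v : H2 U) : H1 U := ⟨(v.1.1, v.1.2.1), v.2.1⟩

/-- The underlying function of an element of `H²(U)`. -/
def H2.fn (v : H2 U) : L2 U := v.1.1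

/-- The weak Laplacian `Δ v = ∂₁∂₁ v + ∂₂∂₂ v` of `v ∈ H²(U)`. -/
def H2.laplacian (v : H2 U) : L2 U := ∑ i, v.1.2.2 i i

/-- `∂ₙ v = 0` on `∂U`, for `v ∈ H²(U)`: the normal trace of `∇v`, which is the functional
`ψ ↦ ∫_U ∇v · ∇ψ + ∫_U Δv ψ` (equal to `∫_{∂U} ψ ∂ₙ v` by Green's formula), vanishes on
`H¹(U)`. -/
def HasZeroNormalDerivative (v : H2 U) : Prop :=
  ∀ ψ : H1 U, (∫ x in U, ∑ i, v.toH1.d i x * ψ.d i x) + ∫ x in U, v.laplacian x * ψ.fn x = 0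

/-- Lebesgue measure on the time interval `(0, T)`. -/
abbrev timeMeasure (T : ℝ) : Measure ℝ := (volume : Measure ℝ).restrict (Ioo 0 T)

/-- `f ∈ H¹(0, T; L²(U))`: `f` and its weak time derivative belong to `L²(0, T; L²(U))`. -/
def MemH1Time (T : ℝ) (f : ℝ → L2 U) : Prop :=
  MemLp f 2 (timeMeasure T) ∧ ∃ f' : ℝ → L2 U, MemLp f' 2 (timeMeasure T) ∧
    ∀ θ : ℝ → ℝ, ContDiff ℝ ∞ θ → HasCompactSupport θ → tsupport θ ⊆ Ioo 0 T →
      ∫ t in Ioo 0 T, deriv θ t • f t = - ∫ t in Ioo 0 T, θ t • f' t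

/-- The flux term `∫_U (η + a(z)) ∇u · ∇ξ dx`: its integrand. -/
def fluxTerm (η : ℝ) (a : ℝ → ℝ) (u z : H1 U) (ξ : Plane → ℝ) (x : Plane) : ℝ :=
  (η + a (z.fn x)) * ∑ i, u.d i x * pd i ξ x

/-- The reaction term `∫_U b(z) |∇u|² ξ dx`: its integrand. -/
def reactionTerm (b : ℝ → ℝ) (u z : H1 U) (ξ : Plane → ℝ) (x : Plane) : ℝ :=
  b (z.fn x) * (∑ i, (u.d i x) ^ 2) * ξ x

/-- `(u, z)` is a weak solution on `(0, T) × U` of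
`∂ₜ u = div ((η + a(z)) ∇u) - (u - g)`,
`∂ₜ z = 2 ε Δz - b(z) |∇u|² + (1 - z) / (2 ε)`,
`u(0) = u₀`, `z(0) = z₀`, tested against `C_c^∞(U)`. The two fields `integrable_flux` and
`integrable_reaction` say that the nonlinear integrals in the equations exist; the other integrals
always do. -/
structure IsWeakSolution (U : Set Plane) (T ε η : ℝ) (a b : ℝ → ℝ) (g : L2 U) (u₀ z₀ : L2 U)
    (u z : ℝ → H1 U) : Prop where
  u_linfty_L2 : MemLp (fun t => (u t).fn) ∞ (timeMeasure T)
  z_linfty_L2 : MemLp (fun t => (z t).fn) ∞ (timeMeasure T)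
  u_L2_H1 : MemLp u 2 (timeMeasure T)
  z_L2_H1 : MemLp z 2 (timeMeasure T)
  integrable_flux : ∀ ξ : Plane → ℝ, IsTestFunction U ξ →
    (∀ᵐ s ∂(timeMeasure T), IntegrableOn (fluxTerm η a (u s) (z s) ξ) U) ∧
    IntegrableOn (fun s => ∫ x in U, fluxTerm η a (u s) (z s) ξ x) (Ioo 0 T)
  integrable_reaction : ∀ ξ : Plane → ℝ, IsTestFunction U ξ →
    (∀ᵐ s ∂(timeMeasure T), IntegrableOn (reactionTerm b (u s) (z s) ξ) U) ∧
    IntegrableOn (fun s => ∫ x in U, reactionTerm b (u s) (z s) ξ x) (Ioo 0 T)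
  u_equation : ∀ᵐ t ∂(timeMeasure T), ∀ ξ : Plane → ℝ, IsTestFunction U ξ →
    ∫ x in U, (u t).fn x * ξ x = (∫ x in U, u₀ x * ξ x)
      - (∫ s in (0 : ℝ)..t, ∫ x in U, fluxTerm η a (u s) (z s) ξ x)
      - ∫ s in (0 : ℝ)..t, ∫ x in U, ((u s).fn x - g x) * ξ x
  z_equation : ∀ᵐ t ∂(timeMeasure T), ∀ ξ : Plane → ℝ, IsTestFunction U ξ →
    ∫ x in U, (z t).fn x * ξ x = (∫ x in U, z₀ x * ξ x)
      - (∫ s in (0 : ℝ)..t, ∫ x in U, 2 * ε * ∑ i, (z s).d i x * pd i ξ x)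
      - (∫ s in (0 : ℝ)..t, ∫ x in U, reactionTerm b (u s) (z s) ξ x)
      + ∫ s in (0 : ℝ)..t, ∫ x in U, (1 - (z s).fn x) / (2 * ε) * ξ x

/-- A strong solution: a weak solution in
`[L²(0, T; H²(U)) ∩ L^∞(0, T; H¹(U)) ∩ H¹(0, T; L²(U))]²` that satisfies the homogeneous Neumann
boundary conditions `∂ₙ u = ∂ₙ z = 0`. -/
structure IsStrongSolution (U : Set Plane) (T ε η : ℝ) (a b : ℝ → ℝ) (g : L2 U) (u₀ z₀ : L2 U)
    (u z : ℝ → H2 U) : Prop where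
  isWeakSolution : IsWeakSolution U T ε η a b g u₀ z₀ (fun t => (u t).toH1) (fun t => (z t).toH1)
  u_L2_H2 : MemLp u 2 (timeMeasure T)
  z_L2_H2 : MemLp z 2 (timeMeasure T)
  u_linfty_H1 : MemLp (fun t => (u t).toH1) ∞ (timeMeasure T)
  z_linfty_H1 : MemLp (fun t => (z t).toH1) ∞ (timeMeasure T)
  u_H1_L2 : MemH1Time T (fun t => (u t).fn)
  z_H1_L2 : MemH1Time T (fun t => (z t).fn)
  u_neumann : ∀ᵐ t ∂(timeMeasure T), HasZeroNormalDerivative (u t)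
  z_neumann : ∀ᵐ t ∂(timeMeasure T), HasZeroNormalDerivative (z t)

/-- Strong solutions of the gradient flow of the Ambrosio–Tortorelli functional. -/
def IsStrongSolutionAT (U : Set Plane) (T ε η : ℝ) (g : L2 U) (u₀ z₀ : H1 U)
    (u z : ℝ → H2 U) : Prop :=
  IsStrongSolution U T ε η (fun s => s ^ 2) (fun s => s) g u₀.fn z₀.fn u z

/-- Strong solutions of the system cut off by `φ`. -/
def IsStrongSolutionCutoff (φ : ℝ → ℝ) (U : Set Plane) (T ε η : ℝ) (g : L2 U) (u₀ z₀ : H1 U)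
    (u z : ℝ → H2 U) : Prop :=
  IsStrongSolution U T ε η (fun s => φ s ^ 2) (fun s => deriv φ s * φ s) g u₀.fn z₀.fn u z

/-- A smooth nondecreasing cutoff function, equal to `-1` on `(-∞, -1]`, to the identity on
`(0, 1)` and to `2` on `[2, ∞)`. -/
structure IsCutoff (φ : ℝ → ℝ) : Prop where
  smooth : ContDiff ℝ ∞ φ
  monotone : Monotone φ
  eq_neg_one : ∀ s, s ≤ -1 → φ s = -1
  eq_self : ∀ s, 0 < s → s < 1 → φ s = s
  eq_two : ∀ s, 2 ≤ s → φ s = 2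

/-- `w` is the continuous representative in `C([0, T]; L²(U))` of `f`. -/
def IsContinuousRepresentative (T : ℝ) (f w : ℝ → L2 U) : Prop :=
  ContinuousOn w (Icc 0 T) ∧ ∀ᵐ t ∂(timeMeasure T), w t = f t

end Solutions

end AmbrosioTortorelli

end

open AmbrosioTortorelli

/-! This is a maximum principle by a penalty argument. Take a convex `C²` function `penalty` that
vanishes on `[0, 1]` and is positive elsewhere, and follow `∫_U penalty (z t)` in time. Formally its
derivative is `∫_U penaltyDeriv z * ∂ₜ z`, and each term of the equation for `z` contributes a
nonpositive amount. Diffusion gives `-2ε ∫ penaltySlope z * |∇z|²` by the Neumann condition. The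
reaction term has a sign because `penaltyDeriv s` and `φ s` are both nonpositive for `s < 0` and
both nonnegative for `s > 1`, while `φ' ≥ 0`. The relaxation term has a sign because `penaltyDeriv s
* (1 - s) ≤ 0`. The functional starts at zero and is nonnegative, so it stays zero, which means `0 ≤
z ≤ 1`. On `[0, 1]` one has `φ s = s` and `φ' s = 1`, so the cut-off coefficients agree with the
original ones along the solution.

Three points make the computation rigorous. The chain rule in `H¹(U)`
(`HasWeakPartial.integral_comp_mul_pd`, `H1.exists_comp`) makes `penaltyDeriv z` admissible in the
Neumann condition. A function with an integrable weak time derivative is a primitive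
(`exists_ae_eq_primitive_of_weak_deriv`), which supplies the continuous representative, and the
equation then holds almost everywhere with initial value `z₀` (`IsStrongSolution.exists_primitive`).
Finally, `le_of_ae_inner_gradient_nonpos` differentiates the functional along this absolutely
continuous curve in `L²(U)`. -/

noncomputable section

namespace AmbrosioTortorelli

open Filter Topology
open scoped Convolution

/-! ### Convergence of mollifications in `L¹`. -/

section Mollification

theorem exists_integral_translate_sub_le {f : Plane → ℝ} (hf : Integrable f) {r : ℝ}
    (hr : 0 < r) :
    ∃ δ > 0, ∀ y : Plane, ‖y‖ < δ → ∫ x, ‖f (x - y) - f x‖ ≤ r := by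
  have hf1 : MemLp f 1 := memLp_one_iff_integrable.2 hf
  let τ : C(Plane, C(Plane, Plane)) :=
    (ContinuousMap.mk (fun p : Plane × Plane => p.2 - p.1) (by fun_prop)).curry
  have hτ : ∀ y, MeasurePreserving (τ y) (volume : Measure Plane) volume := fun y =>
    measurePreserving_sub_right volume y
  have hc : Continuous fun y => Lp.compMeasurePreserving (τ y) (hτ y) hf1.toLp :=
    continuous_const.compMeasurePreservingLp τ.continuous hτ (by simp)
  have h0 : Lp.compMeasurePreserving (τ 0) (hτ 0) hf1.toLp = hf1.toLp := by
    rw [Lp.toLp_compMeasurePreserving hf1 (hτ 0)]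
    congr 1
    ext x
    simp [τ]
  obtain ⟨δ, hδ, H⟩ := Metric.continuous_iff.1 hc 0 r hr
  refine ⟨δ, hδ, fun y hy => ?_⟩
  have h1 := (H y (by simpa using hy)).le
  rw [h0, dist_eq_norm, L1.norm_eq_integral_norm] at h1
  refine le_of_eq_of_le (integral_congr_ae ?_) h1
  rw [Lp.toLp_compMeasurePreserving hf1 (hτ y)]
  filter_upwards [Lp.coeFn_sub (MemLp.toLp _ (hf1.comp_measurePreserving (hτ y))) (hf1.toLp),
    hf1.coeFn_toLp, (hf1.comp_measurePreserving (hτ y)).coeFn_toLp] with x h2 h3 h4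
  rw [h2, Pi.sub_apply, h3, h4]
  rfl

theorem integrable_bump_convolution (ρ : ContDiffBump (0 : Plane)) {f : Plane → ℝ}
    (hf : Integrable f) :
    Integrable (ρ.normed volume ⋆[ContinuousLinearMap.lsmul ℝ ℝ, volume] f) :=
  ρ.integrable_normed.integrable_convolution _ hf

/-- The bump has mass one, so the error is a weighted average of the differences `f (x - y) - f x`
over `‖y‖ < ρ.rOut`; Fubini moves the average outside the `L¹` norm. -/
theorem integral_norm_bump_convolution_sub_le (ρ : ContDiffBump (0 : Plane)) {f : Plane → ℝ}
    (hf : Integrable f) {r : ℝ}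
    (h : ∀ y : Plane, ‖y‖ < ρ.rOut → ∫ x, ‖f (x - y) - f x‖ ≤ r) :
    ∫ x, ‖(ρ.normed volume ⋆[ContinuousLinearMap.lsmul ℝ ℝ, volume] f) x - f x‖ ≤ r := by
  have hi1 : Integrable (fun p : Plane × Plane => ρ.normed volume p.2 * f (p.1 - p.2))
      (volume.prod volume) :=
    ρ.integrable_normed.convolution_integrand (ContinuousLinearMap.lsmul ℝ ℝ) hf
  have hi2 : Integrable (fun p : Plane × Plane => ρ.normed volume p.2 * f p.1)
      (volume.prod volume) := by
    simpa [mul_comm] using hf.mul_prod (ρ.integrable_normed (μ := volume))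
  have hi : Integrable (fun p : Plane × Plane =>
      ρ.normed volume p.2 * ‖f (p.1 - p.2) - f p.1‖) (volume.prod volume) := by
    refine (hi1.sub hi2).norm.congr (ae_of_all _ fun p => ?_)
    simp only [Pi.sub_apply, ← mul_sub, norm_mul, Real.norm_of_nonneg (ρ.nonneg_normed _)]
  have hb : ∀ᵐ x : Plane,
      ‖(ρ.normed volume ⋆[ContinuousLinearMap.lsmul ℝ ℝ, volume] f) x - f x‖ ≤
        ∫ y, ρ.normed volume y * ‖f (x - y) - f x‖ := by
    filter_upwards [hi1.prod_right_ae, hi2.prod_right_ae] with x h1 h2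
    have : (ρ.normed volume ⋆[ContinuousLinearMap.lsmul ℝ ℝ, volume] f) x - f x =
        ∫ y, ρ.normed volume y * (f (x - y) - f x) := by
      simp only [mul_sub]
      rw [integral_sub h1 h2, integral_mul_const, ρ.integral_normed, one_mul]
      rfl
    rw [this]
    refine (norm_integral_le_integral_norm _).trans_eq (integral_congr_ae (ae_of_all _ fun y => ?_))
    simp only [norm_mul, Real.norm_of_nonneg (ρ.nonneg_normed _)]
  calc _ ≤ ∫ x, ∫ y, ρ.normed volume y * ‖f (x - y) - f x‖ :=
        integral_mono_ae ((integrable_bump_convolution ρ hf).sub hf).norm hi.integral_prod_left hb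
    _ = ∫ y, ∫ x, ρ.normed volume y * ‖f (x - y) - f x‖ := integral_integral_swap hi
    _ ≤ ∫ y, ρ.normed volume y * r := by
        refine integral_mono hi.integral_prod_right (ρ.integrable_normed.mul_const r) fun y => ?_
        simp only [integral_const_mul]
        by_cases hy : ‖y‖ < ρ.rOut
        · exact mul_le_mul_of_nonneg_left (h y hy) (ρ.nonneg_normed _)
        · have : ρ.normed volume y = 0 := by
            have := ρ.support_normed_eq (μ := volume)
            by_contra hne
            have h2 : y ∈ Function.support (ρ.normed volume) := hne
            rw [this] at h2
            exact hy (by simpa using h2)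
          simp [this]
    _ = r := by rw [integral_mul_const, ρ.integral_normed, one_mul]

/-- Mollifications of an integrable function converge in `L¹`. -/
theorem tendsto_integral_norm_bump_convolution_sub {ρ : ℕ → ContDiffBump (0 : Plane)}
    (hρ : Tendsto (fun n => (ρ n).rOut) atTop (𝓝 0)) {f : Plane → ℝ} (hf : Integrable f) :
    Tendsto (fun n => ∫ x,
      ‖((ρ n).normed volume ⋆[ContinuousLinearMap.lsmul ℝ ℝ, volume] f) x - f x‖)
      atTop (𝓝 0) := by
  rw [Metric.tendsto_nhds]
  intro r hr
  obtain ⟨δ, hδ, H⟩ := exists_integral_translate_sub_le hf (half_pos hr)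
  filter_upwards [hρ.eventually (gt_mem_nhds hδ)] with n hn
  rw [dist_zero_right, Real.norm_of_nonneg (integral_nonneg fun _ => norm_nonneg _)]
  exact (integral_norm_bump_convolution_sub_le (ρ n) hf
    fun y hy => H y (hy.trans hn)).trans_lt (half_lt_self hr)

end Mollification

/-! ### Mollification of weak derivatives. -/

section ChainRule

variable {U : Set Plane}

theorem integrable_indicator_L2 (hU : IsOpen U) (hUb : Bornology.IsBounded U) (f : L2 U) :
    Integrable (U.indicator f) := by
  have : IsFiniteMeasure ((volume : Measure Plane).restrict U) :=
    ⟨by simpa using hUb.measure_lt_top⟩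
  exact (integrable_indicator_iff hU.measurableSet).2 ((Lp.memLp f).integrable (by norm_num))

theorem isTestFunction_bump_comp_sub {ρ : ContDiffBump (0 : Plane)} {x : Plane}
    (h : Metric.closedBall x ρ.rOut ⊆ U) :
    IsTestFunction U fun y => ρ.normed volume (x - y) := by
  have hs : tsupport (fun y => ρ.normed volume (x - y)) ⊆ Metric.closedBall x ρ.rOut := by
    refine closure_minimal (fun y hy => ?_) Metric.isClosed_closedBall
    have h2 : x - y ∈ Function.support (ρ.normed volume) := hy
    rw [ρ.support_normed_eq] at h2
    rw [Metric.mem_closedBall, dist_comm, dist_eq_norm]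
    simpa using (mem_ball_zero_iff.1 h2).le
  exact ⟨ρ.contDiff_normed.comp (contDiff_const.sub contDiff_id),
    HasCompactSupport.of_support_subset_isCompact (isCompact_closedBall x ρ.rOut)
      ((subset_tsupport _).trans hs), hs.trans h⟩

theorem contDiff_bump_convolution (ρ : ContDiffBump (0 : Plane)) {f : Plane → ℝ}
    (hf : Integrable f) :
    ContDiff ℝ 1 (ρ.normed volume ⋆[ContinuousLinearMap.lsmul ℝ ℝ, volume] f) :=
  ρ.hasCompactSupport_normed.contDiff_convolution_left _ ρ.contDiff_normed hf.locallyIntegrable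

/-- Mollification commutes with the weak derivative away from the boundary. -/
theorem pd_bump_convolution (hU : IsOpen U) (hUb : Bornology.IsBounded U) {i : Fin 2}
    {f h : L2 U} (H : HasWeakPartial U i f h) {ρ : ContDiffBump (0 : Plane)} {x : Plane}
    (hx : Metric.closedBall x ρ.rOut ⊆ U) :
    pd i (ρ.normed volume ⋆[ContinuousLinearMap.lsmul ℝ ℝ, volume] (U.indicator f)) x =
      (ρ.normed volume ⋆[ContinuousLinearMap.lsmul ℝ ℝ, volume] (U.indicator h)) x := by
  have hf := integrable_indicator_L2 hU hUb f
  have hρ1 : ContDiff ℝ 1 (ρ.normed (volume : Measure Plane)) := ρ.contDiff_normed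
  have hd := ρ.hasCompactSupport_normed.hasFDerivAt_convolution_left
    (ContinuousLinearMap.lsmul ℝ ℝ) hρ1 hf.locallyIntegrable (μ := volume) x
  have hce : ConvolutionExistsAt (fderiv ℝ (ρ.normed volume)) (U.indicator f) x
      ((ContinuousLinearMap.lsmul ℝ ℝ).precompL Plane) volume :=
    (ρ.hasCompactSupport_normed.fderiv ℝ).convolutionExists_left _
      (hρ1.continuous_fderiv one_ne_zero) hf.locallyIntegrable x
  -- The ball lies in `U` exactly so that `y ↦ ρ (x - y)` is a test function. The sign produced by
  -- differentiating in `y` cancels the one in the definition of the weak derivative.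
  have ht := H _ (isTestFunction_bump_comp_sub hx)
  have hpd : ∀ y, pd i (fun y => ρ.normed volume (x - y)) y =
      - fderiv ℝ (ρ.normed volume) (x - y) (EuclideanSpace.single i 1) := fun y => by
    have h1 := ((hρ1.differentiable one_ne_zero (x - y)).hasFDerivAt).comp y
      ((hasFDerivAt_id y).const_sub x)
    have h2 : HasFDerivAt (fun y => ρ.normed volume (x - y)) _ y := h1
    rw [pd, h2.fderiv]
    simp
  rw [pd, hd.fderiv, convolution_def, ContinuousLinearMap.integral_apply hce]
  rw [convolution_eq_swap]
  have e1 : ∀ t, ((ContinuousLinearMap.lsmul ℝ ℝ).precompL Plane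
      (fderiv ℝ (ρ.normed volume) t) (U.indicator f (x - t))) (EuclideanSpace.single i 1) =
      (fun y => fderiv ℝ (ρ.normed volume) (x - y) (EuclideanSpace.single i 1) *
        U.indicator f y) (x - t) := fun t => by
    simp
  simp only [e1]
  rw [integral_sub_left_eq_self (fun y => fderiv ℝ (ρ.normed volume) (x - y)
    (EuclideanSpace.single i 1) * U.indicator f y) volume x]
  simp only [hpd, mul_neg, integral_neg, neg_inj] at ht
  rw [← integral_indicator hU.measurableSet, ← integral_indicator hU.measurableSet] at ht
  refine Eq.trans (integral_congr_ae (ae_of_all _ fun y => ?_))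
    (ht.trans (integral_congr_ae (ae_of_all _ fun y => ?_)))
  · by_cases hy : y ∈ U <;> simp [hy, mul_comm]
  · by_cases hy : y ∈ U <;> simp [hy, mul_comm]

end ChainRule

/-! ### The chain rule in `H¹(U)` and the sign of the Neumann Laplacian. -/

section ChainRule

variable {U : Set Plane}

theorem IsTestFunction.eq_zero_of_notMem {ξ : Plane → ℝ} (hξ : IsTestFunction U ξ) {x : Plane}
    (hx : x ∉ U) : ξ x = 0 :=
  image_eq_zero_of_notMem_tsupport fun h => hx (hξ.tsupport_subset h)

theorem IsTestFunction.continuous_pd {ξ : Plane → ℝ} (hξ : IsTestFunction U ξ) (i : Fin 2) :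
    Continuous (pd i ξ) :=
  (hξ.smooth.continuous_fderiv (by simp)).clm_apply continuous_const

theorem IsTestFunction.hasCompactSupport_pd {ξ : Plane → ℝ} (hξ : IsTestFunction U ξ)
    (i : Fin 2) : HasCompactSupport (pd i ξ) :=
  hξ.hasCompactSupport.fderiv_apply (𝕜 := ℝ) _

theorem IsTestFunction.pd_eq_zero_of_notMem {ξ : Plane → ℝ} (hξ : IsTestFunction U ξ)
    (i : Fin 2) {x : Plane} (hx : x ∉ U) : pd i ξ x = 0 := by
  have h : x ∉ tsupport (fderiv ℝ ξ) := fun h =>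
    hx (hξ.tsupport_subset (tsupport_fderiv_subset ℝ h))
  simp [pd, image_eq_zero_of_notMem_tsupport h]

/-- The classical case of the chain rule, to be applied to mollifications: integration by parts on
the whole plane, where the compact support of `ξ` gives integrability of every product. -/
theorem integral_comp_mul_pd_of_contDiff {ξ : Plane → ℝ} (hξ : IsTestFunction U ξ) (i : Fin 2)
    {k k' : ℝ → ℝ} (hk : ∀ s, HasDerivAt k (k' s) s) (hk' : Continuous k') {F : Plane → ℝ}
    (hF : ContDiff ℝ 1 F) :
    ∫ x, k (F x) * pd i ξ x = - ∫ x, k' (F x) * pd i F x * ξ x := by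
  have hFd : Differentiable ℝ F := hF.differentiable one_ne_zero
  have hkc : Continuous k := continuous_iff_continuousAt.2 fun s => (hk s).continuousAt
  have hfd : ∀ x, HasFDerivAt (fun x => k (F x)) (k' (F x) • fderiv ℝ F x) x := fun x =>
    (hk (F x)).comp_hasFDerivAt x (hFd x).hasFDerivAt
  have hpF : Continuous (pd i F) :=
    (hF.continuous_fderiv one_ne_zero).clm_apply continuous_const
  have e : ∀ x, fderiv ℝ (fun x => k (F x)) x (EuclideanSpace.single i 1) =
      k' (F x) * pd i F x := fun x => by
    rw [(hfd x).fderiv]; rfl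
  have hc := hξ.hasCompactSupport
  have := integral_mul_fderiv_eq_neg_fderiv_mul_of_integrable (μ := (volume : Measure Plane))
    (f := fun x => k (F x)) (g := ξ) (v := EuclideanSpace.single i (1 : ℝ))
    (by
      simp only [e]
      exact (((hk'.comp hF.continuous).mul hpF).mul hξ.smooth.continuous
        ).integrable_of_hasCompactSupport hc.mul_left)
    (((hkc.comp hF.continuous).mul (hξ.continuous_pd i)).integrable_of_hasCompactSupport
      (hξ.hasCompactSupport_pd i).mul_left)
    (((hkc.comp hF.continuous).mul hξ.smooth.continuous).integrable_of_hasCompactSupport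
      hc.mul_left)
    (fun x _ => (hfd x).differentiableAt)
    (fun x _ => hξ.smooth.differentiable (by simp) x)
  simp only [e] at this
  exact this

/-- The bump function at the origin with radii `1 / (n + 1)` and `2 / (n + 1)`. -/
def shrinkingBump (n : ℕ) : ContDiffBump (0 : Plane) where
  rIn := 1 / ((n : ℝ) + 1)
  rOut := 2 * (1 / ((n : ℝ) + 1))
  rIn_pos := by positivity
  rIn_lt_rOut := by
    have : (0 : ℝ) < 1 / ((n : ℝ) + 1) := by positivity
    linarith

theorem tendsto_shrinkingBump_rOut : Tendsto (fun n => (shrinkingBump n).rOut) atTop (𝓝 0) := by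
  simpa [shrinkingBump] using (tendsto_one_div_add_atTop_nhds_zero_nat (𝕜 := ℝ)).const_mul 2

/-- The chain rule for weak derivatives. -/
theorem HasWeakPartial.integral_comp_mul_pd (hU : IsOpen U) (hUb : Bornology.IsBounded U)
    {i : Fin 2} {f h : L2 U} (H : HasWeakPartial U i f h) {k k' : ℝ → ℝ} {M : ℝ}
    (hk : ∀ s, HasDerivAt k (k' s) s) (hk' : Continuous k') (hM : ∀ s, ‖k' s‖ ≤ M)
    {ξ : Plane → ℝ} (hξ : IsTestFunction U ξ) :
    ∫ x in U, k (f x) * pd i ξ x = - ∫ x in U, k' (f x) * h x * ξ x := by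
  have hkc : Continuous k := continuous_iff_continuousAt.2 fun s => (hk s).continuousAt
  have hM0 : 0 ≤ M := (norm_nonneg _).trans (hM 0)
  have hkl : ∀ s t, ‖k s - k t‖ ≤ M * ‖s - t‖ := fun s t =>
    convex_univ.norm_image_sub_le_of_norm_hasDerivWithin_le
      (fun x _ => (hk x).hasDerivWithinAt) (fun x _ => hM x) (mem_univ _) (mem_univ _)
  set F := U.indicator f with hFdef
  set G := U.indicator h with hGdef
  have hF : Integrable F := integrable_indicator_L2 hU hUb f
  have hG : Integrable G := integrable_indicator_L2 hU hUb h
  set Fn : ℕ → Plane → ℝ := fun n =>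
    (shrinkingBump n).normed volume ⋆[ContinuousLinearMap.lsmul ℝ ℝ, volume] F with hFn
  set Gn : ℕ → Plane → ℝ := fun n =>
    (shrinkingBump n).normed volume ⋆[ContinuousLinearMap.lsmul ℝ ℝ, volume] G with hGn
  have hFnc : ∀ n, ContDiff ℝ 1 (Fn n) := fun n => contDiff_bump_convolution _ hF
  have hFnL := tendsto_integral_norm_bump_convolution_sub tendsto_shrinkingBump_rOut hF
  have hGnL := tendsto_integral_norm_bump_convolution_sub tendsto_shrinkingBump_rOut hG
  have hFni : ∀ n, Integrable (Fn n) := fun n => integrable_bump_convolution _ hF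
  have hGni : ∀ n, Integrable (Gn n) := fun n => integrable_bump_convolution _ hG
  -- Almost everywhere convergence needs the two radii to be comparable; `shrinkingBump` has `rOut =
  -- 2 * rIn`, whence `K = 2`.
  have hFae : ∀ᵐ x, Tendsto (fun n => Fn n x) atTop (𝓝 (F x)) :=
    ContDiffBump.ae_convolution_tendsto_right_of_locallyIntegrable (K := 2)
      tendsto_shrinkingBump_rOut (Eventually.of_forall fun n => le_rfl) hF.locallyIntegrable
  obtain ⟨C, hC⟩ := hξ.hasCompactSupport.exists_bound_of_continuous hξ.smooth.continuous
  obtain ⟨D, hD⟩ := (hξ.hasCompactSupport_pd i).exists_bound_of_continuous (hξ.continuous_pd i)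
  have hC0 : 0 ≤ C := (norm_nonneg _).trans (hC 0)
  obtain ⟨δ, hδ, hδU⟩ := IsCompact.exists_cthickening_subset_open (hξ.hasCompactSupport) hU
    hξ.tsupport_subset
  -- Once `rOut` is below the distance `δ`, mollification commutes with the weak derivative at every
  -- point of the support of `ξ`.
  have hEq : ∀ᶠ n in atTop,
      ∫ x, k (Fn n x) * pd i ξ x = - ∫ x, k' (Fn n x) * Gn n x * ξ x := by
    filter_upwards [tendsto_shrinkingBump_rOut.eventually (gt_mem_nhds hδ)] with n hn
    rw [integral_comp_mul_pd_of_contDiff hξ i hk hk' (hFnc n)]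
    congr 1
    refine integral_congr_ae (ae_of_all _ fun x => ?_)
    by_cases hx : x ∈ tsupport ξ
    · have hb : Metric.closedBall x (shrinkingBump n).rOut ⊆ U :=
        ((Metric.closedBall_subset_closedBall hn.le).trans
          (Metric.closedBall_subset_cthickening hx δ)).trans hδU
      have := pd_bump_convolution hU hUb H hb
      simp only [hFn, hGn, hFdef, hGdef]
      rw [this]
    · simp [image_eq_zero_of_notMem_tsupport hx]
  -- limit of the left-hand side
  have hL : Tendsto (fun n => ∫ x, k (Fn n x) * pd i ξ x) atTop
      (𝓝 (∫ x, k (F x) * pd i ξ x)) := by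
    have hdiff : ∀ n, Integrable fun x => (k (Fn n x) - k (F x)) * pd i ξ x := fun n => by
      refine (((hFni n).sub hF).norm.const_mul (M * D)).mono'
        (((hkc.comp_aestronglyMeasurable (hFni n).1).sub
          (hkc.comp_aestronglyMeasurable hF.1)).mul
          (hξ.continuous_pd i).aestronglyMeasurable) (ae_of_all _ fun x => ?_)
      rw [norm_mul]
      have := mul_le_mul (hkl (Fn n x) (F x)) (hD x) (norm_nonneg _) (by positivity)
      simp only [Pi.sub_apply]
      linarith
    have h1 : ∀ n, Integrable fun x => k (Fn n x) * pd i ξ x := fun n =>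
      ((hkc.comp (hFnc n).continuous).mul (hξ.continuous_pd i)).integrable_of_hasCompactSupport
        (hξ.hasCompactSupport_pd i).mul_left
    have h2 : Integrable fun x => k (F x) * pd i ξ x := by
      refine ((h1 0).sub (hdiff 0)).congr (ae_of_all _ fun x => ?_)
      simp only [Pi.sub_apply]
      ring
    rw [tendsto_iff_norm_sub_tendsto_zero]
    refine squeeze_zero (fun _ => norm_nonneg _) (fun n => ?_)
      (by simpa using hFnL.const_mul (M * D))
    rw [← integral_sub (h1 n) h2, ← integral_const_mul]
    refine norm_integral_le_of_norm_le (((hFni n).sub hF).norm.const_mul (M * D))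
      (ae_of_all _ fun x => ?_)
    rw [← sub_mul, norm_mul]
    refine (mul_le_mul (hkl (Fn n x) (F x)) (hD x) (norm_nonneg _) (by positivity)).trans_eq
      (?_ : _ = M * D * ‖Fn n x - F x‖)
    ring
  -- limit of the right-hand side
  have hbd : ∀ s t x, ‖k' s * t * ξ x‖ ≤ M * C * ‖t‖ := fun s t x => by
    rw [norm_mul, norm_mul]
    calc ‖k' s‖ * ‖t‖ * ‖ξ x‖ ≤ M * ‖t‖ * C := by gcongr <;> simp only [hM, hC]
      _ = M * C * ‖t‖ := by ring
  have hR : Tendsto (fun n => ∫ x, k' (Fn n x) * Gn n x * ξ x) atTop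
      (𝓝 (∫ x, k' (F x) * G x * ξ x)) := by
    have hm : ∀ n (g : Plane → ℝ), AEStronglyMeasurable g →
        AEStronglyMeasurable fun x => k' (Fn n x) * g x * ξ x := fun n g hg =>
      (((hk'.comp (hFnc n).continuous).aestronglyMeasurable).mul hg).mul
        hξ.smooth.continuous.aestronglyMeasurable
    have hi1 : ∀ n (g : Plane → ℝ), Integrable g →
        Integrable fun x => k' (Fn n x) * g x * ξ x := fun n g hg =>
      (hg.norm.const_mul (M * C)).mono' (hm n g hg.1) (ae_of_all _ fun x => hbd _ _ _)
    -- As `k'` is only continuous and bounded, the product is split: dominated convergence for `k'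
    -- (Fn n)` against the fixed `G`, and `L¹` convergence for the remainder `Gn n - G`.
    have hA : Tendsto (fun n => ∫ x, k' (Fn n x) * G x * ξ x) atTop
        (𝓝 (∫ x, k' (F x) * G x * ξ x)) := by
      refine tendsto_integral_of_dominated_convergence (fun x => M * C * ‖G x‖)
        (fun n => hm n G hG.1) (hG.norm.const_mul _) (fun n => ae_of_all _ fun x => hbd _ _ _) ?_
      filter_upwards [hFae] with x hx
      exact (((hk'.tendsto _).comp hx).mul_const _).mul_const _
    have hB : Tendsto (fun n => ∫ x, k' (Fn n x) * (Gn n x - G x) * ξ x) atTop (𝓝 0) := by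
      refine squeeze_zero_norm (fun n => ?_) (by simpa using hGnL.const_mul (M * C))
      rw [← integral_const_mul]
      exact norm_integral_le_of_norm_le (((hGni n).sub hG).norm.const_mul (M * C))
        (ae_of_all _ fun x => hbd _ _ _)
    refine (by simpa using hA.add hB : Tendsto _ _ (𝓝 (∫ x, k' (F x) * G x * ξ x))).congr
      fun n => ?_
    rw [← integral_add (hi1 n G hG) (hi1 n (fun x => Gn n x - G x) ((hGni n).sub hG))]
    refine integral_congr_ae (ae_of_all _ fun x => ?_)
    ring
  have hfin := tendsto_nhds_unique (hL.congr' hEq) hR.neg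
  rw [← integral_indicator hU.measurableSet, ← integral_indicator hU.measurableSet]
  refine Eq.trans (integral_congr_ae (ae_of_all _ fun x => ?_))
    (hfin.trans (congrArg _ (integral_congr_ae (ae_of_all _ fun x => ?_))))
  · by_cases hx : x ∈ U <;> simp [hFdef, hx, hξ.pd_eq_zero_of_notMem]
  · by_cases hx : x ∈ U <;> simp [hFdef, hGdef, hx, hξ.eq_zero_of_notMem]

/-- Composition with a `C¹` function with bounded derivative preserves `H¹(U)`. -/
theorem H1.exists_comp (hU : IsOpen U) (hUb : Bornology.IsBounded U) (v : H1 U) {k k' : ℝ → ℝ}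
    {M : ℝ} (hk : ∀ s, HasDerivAt k (k' s) s) (hk' : Continuous k') (hM : ∀ s, ‖k' s‖ ≤ M)
    (hk0 : k 0 = 0) :
    ∃ ψ : H1 U, (∀ᵐ x ∂(volume.restrict U), ψ.fn x = k (v.fn x)) ∧
      ∀ i, ∀ᵐ x ∂(volume.restrict U), ψ.d i x = k' (v.fn x) * v.d i x := by
  have hkc : Continuous k := continuous_iff_continuousAt.2 fun s => (hk s).continuousAt
  have hkl : ∀ s, ‖k s‖ ≤ M * ‖s‖ := fun s => by
    have := convex_univ.norm_image_sub_le_of_norm_hasDerivWithin_le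
      (fun x _ => (hk x).hasDerivWithinAt) (fun x _ => hM x) (mem_univ (0 : ℝ)) (mem_univ s)
    simpa [hk0] using this
  have h1 : MemLp (fun x => k (v.fn x)) 2 (volume.restrict U) :=
    (Lp.memLp v.fn).of_le_mul (hkc.comp_aestronglyMeasurable (Lp.aestronglyMeasurable _))
      (ae_of_all _ fun x => hkl _)
  have h2 : ∀ i, MemLp (fun x => k' (v.fn x) * v.d i x) 2 (volume.restrict U) := fun i =>
    (Lp.memLp (v.d i)).of_le_mul
      ((hk'.comp_aestronglyMeasurable (Lp.aestronglyMeasurable _)).mul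
        (Lp.aestronglyMeasurable _))
      (ae_of_all _ fun x => by
        rw [norm_mul]
        exact mul_le_mul_of_nonneg_right (hM _) (norm_nonneg _))
  refine ⟨⟨(h1.toLp, fun i => (h2 i).toLp), fun i ξ hξ => ?_⟩, h1.coeFn_toLp,
    fun i => (h2 i).coeFn_toLp⟩
  refine Eq.trans (integral_congr_ae ?_)
    (((v.2 i).integral_comp_mul_pd hU hUb hk hk' hM hξ).trans
      (congrArg _ (integral_congr_ae ?_)))
  · filter_upwards [h1.coeFn_toLp] with x hx
    rw [hx]; rfl
  · filter_upwards [(h2 i).coeFn_toLp] with x hx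
    simp only [hx]; rfl

/-- Under the Neumann condition, `-Δ` is monotone with respect to nondecreasing `C¹` functions. -/
theorem HasZeroNormalDerivative.integral_laplacian_mul_comp_nonpos (hU : IsOpen U)
    (hUb : Bornology.IsBounded U) {v : H2 U} (hv : HasZeroNormalDerivative v) {k k' : ℝ → ℝ}
    {M : ℝ} (hk : ∀ s, HasDerivAt k (k' s) s) (hk' : Continuous k') (hM : ∀ s, ‖k' s‖ ≤ M)
    (hk0 : k 0 = 0) (hpos : ∀ s, 0 ≤ k' s) :
    ∫ x in U, v.laplacian x * k (v.fn x) ≤ 0 := by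
  -- With `ψ = k(v)` the Neumann condition reads `∫ Δv k(v) = -∫ k'(v) |∇v|²`.
  obtain ⟨ψ, hψ, hψd⟩ := v.toH1.exists_comp hU hUb hk hk' hM hk0
  have h := hv ψ
  have h1 : 0 ≤ ∫ x in U, ∑ i, v.toH1.d i x * ψ.d i x := by
    refine integral_nonneg_of_ae ?_
    filter_upwards [ae_all_iff.2 hψd] with x hx
    refine Finset.sum_nonneg fun i _ => ?_
    rw [hx i]
    nlinarith [mul_nonneg (hpos (v.toH1.fn x)) (mul_self_nonneg (v.toH1.d i x))]
  have h2 : ∫ x in U, v.laplacian x * ψ.fn x = ∫ x in U, v.laplacian x * k (v.fn x) := by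
    refine integral_congr_ae ?_
    filter_upwards [hψ] with x hx
    rw [hx]; rfl
  linarith

end ChainRule

/-! ### Weak time derivatives and primitives with values in a Banach space. -/

section TimeDerivative

/-- The sums that define absolute continuity are compared term by term. With `g` a primitive of
`‖F‖`, this reduces absolute continuity of vector-valued curves to the scalar case. -/
theorem absolutelyContinuousOnInterval_of_dist_le {X : Type*} [PseudoMetricSpace X] {f : ℝ → X}
    {g : ℝ → ℝ} {a b C : ℝ} (hg : AbsolutelyContinuousOnInterval g a b)
    (h : ∀ x y, dist (f x) (f y) ≤ C * dist (g x) (g y)) :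
    AbsolutelyContinuousOnInterval f a b := by
  have hg' := Tendsto.const_mul C hg
  rw [mul_zero] at hg'
  refine squeeze_zero (fun t => Finset.sum_nonneg fun i _ => dist_nonneg) (fun t => ?_) hg'
  rw [Finset.mul_sum]
  exact Finset.sum_le_sum fun i _ => h _ _

variable {E : Type*} [NormedAddCommGroup E] [NormedSpace ℝ E]

theorem dist_primitive_le {F : ℝ → E} (hF : Integrable F) (c x y : ℝ) :
    dist (∫ s in c..x, F s) (∫ s in c..y, F s) ≤
      dist (∫ s in c..x, ‖F s‖) (∫ s in c..y, ‖F s‖) := by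
  rw [dist_eq_norm, dist_eq_norm,
    intervalIntegral.integral_interval_sub_left hF.intervalIntegrable hF.intervalIntegrable,
    intervalIntegral.integral_interval_sub_left hF.norm.intervalIntegrable
      hF.norm.intervalIntegrable, Real.norm_eq_abs]
  exact intervalIntegral.norm_integral_le_abs_integral_norm

theorem absolutelyContinuousOnInterval_primitive {F : ℝ → E} (hF : Integrable F) {c a b : ℝ}
    (hc : c ∈ uIcc a b) :
    AbsolutelyContinuousOnInterval (fun t => ∫ s in c..t, F s) a b :=
  absolutelyContinuousOnInterval_of_dist_le (C := 1)
    (hF.norm.intervalIntegrable.absolutelyContinuousOnInterval_intervalIntegral hc)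
    fun x y => by simpa using dist_primitive_le hF c x y

variable [CompleteSpace E]

/-- Integration by parts of a primitive against a test function. -/
theorem integral_deriv_smul_primitive {F : ℝ → E} (hF : Integrable F) {θ : ℝ → ℝ}
    (hθ : ContDiff ℝ ∞ θ) (hc : HasCompactSupport θ) :
    ∫ t, deriv θ t • (∫ s in (0 : ℝ)..t, F s) = - ∫ t, θ t • F t := by
  set G : ℝ → E := fun t => ∫ s in (0 : ℝ)..t, F s with hG
  have hGc : Continuous G := intervalIntegral.continuous_primitive
    (fun _ _ => hF.intervalIntegrable) 0
  have hθ' : Continuous (deriv θ) := hθ.continuous_deriv (by simp)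
  obtain ⟨R, hR⟩ := hc.isCompact.isBounded.subset_ball 0
  obtain ⟨C, hC⟩ := hc.exists_bound_of_continuous hθ.continuous
  have hθR : ∀ t, t ∉ Ioo (-R) R → θ t = 0 := fun t ht =>
    image_eq_zero_of_notMem_tsupport fun h => ht (by
      have := hR h
      simpa [Real.ball_eq_Ioo] using this)
  have i1 : Integrable fun t => deriv θ t • G t :=
    (hθ'.smul hGc).integrable_of_hasCompactSupport hc.deriv.smul_right
  have i2 : Integrable fun t => θ t • F t :=
    hF.bdd_smul C hθ.continuous.aestronglyMeasurable (ae_of_all _ hC)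
  set q : ℝ → E := fun t => deriv θ t • G t + θ t • F t with hq
  have iq : Integrable q := i1.add i2
  -- The ball of radius `R` may be empty; then `θ` vanishes identically.
  by_cases hR0 : R ≤ 0
  · have h0 : ∀ t, θ t = 0 := fun t => hθR t (by rw [Ioo_eq_empty (by linarith)]; simp)
    have : θ = fun _ => 0 := funext h0
    simp [this]
  have h0 : (0 : ℝ) ∈ uIcc (-R) R := by
    rw [uIcc_of_le (by linarith)]; constructor <;> linarith
  -- The product rule: this difference is absolutely continuous with derivative zero almost
  -- everywhere, hence constant. As `θ` vanishes at `±R`, the integral of `q` is zero.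
  have hAC : AbsolutelyContinuousOnInterval (fun t => θ t • G t - ∫ s in (-R)..t, q s) (-R) R :=
    ((hθ.of_le (by simp)).contDiffOn.absolutelyContinuousOnInterval.fun_smul
      (absolutelyContinuousOnInterval_primitive hF h0)).fun_sub
      (absolutelyContinuousOnInterval_primitive iq left_mem_uIcc)
  obtain ⟨K, hK⟩ := hAC.const_of_ae_hasDerivAt_zero (by
    filter_upwards [LocallyIntegrable.ae_hasDerivAt_integral hF.locallyIntegrable,
      LocallyIntegrable.ae_hasDerivAt_integral iq.locallyIntegrable] with t h1 h2 _
    have hd := (((hθ.differentiable (by simp) t).hasDerivAt).smul (h1 0)).sub (h2 (-R))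
    convert! hd using 1
    simp only [hq]
    abel)
  have e1 := hK (-R) left_mem_uIcc
  have e2 := hK R right_mem_uIcc
  simp only [hθR R (by simp), hθR (-R) (by simp), zero_smul, intervalIntegral.integral_same,
    sub_zero, zero_sub] at e1 e2
  rw [← e1, neg_eq_zero, intervalIntegral.integral_eq_integral_of_support_subset] at e2
  · rw [eq_neg_iff_add_eq_zero, ← integral_add i1 i2]
    exact e2
  · intro t ht
    by_contra hn
    have hn' : t ∉ Ioo (-R) R := fun h => hn ⟨h.1, h.2.le⟩
    apply ht
    have hd : deriv θ t = 0 := image_eq_zero_of_notMem_tsupport fun h =>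
      hn' (by
        have := hR (tsupport_deriv_subset h)
        simpa [Real.ball_eq_Ioo] using this)
    simp [hq, hθR t hn', hd]

/-- A smooth function with compact support in `(0, T)` and mean zero is the derivative of
another one. -/
theorem exists_deriv_eq_of_integral_eq_zero {T : ℝ} {φ : ℝ → ℝ} (hφ : ContDiff ℝ ∞ φ)
    (hc : HasCompactSupport φ) (hs : tsupport φ ⊆ Ioo 0 T) (h0 : ∫ t, φ t = 0) :
    ∃ Θ : ℝ → ℝ, ContDiff ℝ ∞ Θ ∧ HasCompactSupport Θ ∧ tsupport Θ ⊆ Ioo 0 T ∧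
      deriv Θ = φ := by
  rcases (tsupport φ).eq_empty_or_nonempty with he | hne
  · have : φ = 0 := tsupport_eq_empty_iff.1 he
    exact ⟨0, contDiff_const, HasCompactSupport.zero, by simp, by simp [this]⟩
  set a := sInf (tsupport φ)
  set b := sSup (tsupport φ)
  have ha : a ∈ Ioo 0 T := hs (hc.isCompact.sInf_mem hne)
  have hb : b ∈ Ioo 0 T := hs (hc.isCompact.sSup_mem hne)
  have hab : ∀ t, t ∉ Icc a b → φ t = 0 := fun t ht =>
    image_eq_zero_of_notMem_tsupport fun h =>
      ht ⟨csInf_le hc.isCompact.bddBelow h, le_csSup hc.isCompact.bddAbove h⟩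
  have hd : ∀ t, HasDerivAt (fun t => ∫ s in (0 : ℝ)..t, φ s) (φ t) t := fun t =>
    intervalIntegral.integral_hasDerivAt_right (hφ.continuous.intervalIntegrable _ _)
      hφ.continuous.aestronglyMeasurable.stronglyMeasurableAtFilter hφ.continuous.continuousAt
  have hde : deriv (fun t => ∫ s in (0 : ℝ)..t, φ s) = φ := funext fun t => (hd t).deriv
  -- To the left of `a` the primitive integrates zero, since `0 < a`; to the right of `b` it equals
  -- the full integral, which is zero.
  have hsupp : tsupport (fun t => ∫ s in (0 : ℝ)..t, φ s) ⊆ Icc a b := by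
    refine closure_minimal (fun t ht => ?_) isClosed_Icc
    by_contra hn
    apply ht
    beta_reduce
    rcases lt_or_ge t a with hta | hta
    · rw [intervalIntegral.integral_congr (g := fun _ => 0)]
      · simp
      · intro x hx
        refine hab x fun h => ?_
        have := hx.2
        rcases le_max_iff.1 this with h1 | h1
        · linarith [h.1, ha.1]
        · linarith [h.1]
    · have htb : b < t := by
        by_contra h
        exact hn ⟨hta, not_lt.1 h⟩
      rw [intervalIntegral.integral_eq_integral_of_support_subset, h0]
      intro x hx
      have : x ∈ Icc a b := by
        by_contra h
        exact hx (hab x h)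
      exact ⟨by linarith [this.1, ha.1], by linarith [this.2]⟩
  refine ⟨_, contDiff_infty_iff_deriv.2 ⟨fun t => (hd t).differentiableAt, by rwa [hde]⟩,
    HasCompactSupport.of_support_subset_isCompact isCompact_Icc
      ((subset_tsupport _).trans hsupp),
    hsupp.trans fun t ht => ⟨ha.1.trans_le ht.1, ht.2.trans_lt hb.2⟩, hde⟩

/-- The lemma of du Bois-Reymond. -/
theorem exists_ae_eq_const_of_integral_deriv_smul_eq_zero {T : ℝ} (hT : 0 < T) {P : ℝ → E}
    (hP : IntegrableOn P (Ioo 0 T))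
    (H : ∀ θ : ℝ → ℝ, ContDiff ℝ ∞ θ → HasCompactSupport θ → tsupport θ ⊆ Ioo 0 T →
      ∫ t in Ioo 0 T, deriv θ t • P t = 0) :
    ∃ c : E, ∀ᵐ t ∂(timeMeasure T), P t = c := by
  -- The outer radius `T / 4` puts the support in `[T / 4, 3 * T / 4]`, inside `(0, T)`.
  let β : ContDiffBump (T / 2) :=
    ⟨T / 8, T / 4, by positivity, by linarith⟩
  set θ₀ : ℝ → ℝ := β.normed volume with hθ₀
  have hs₀ : tsupport θ₀ ⊆ Ioo 0 T := by
    rw [hθ₀, β.tsupport_normed_eq, Real.closedBall_eq_Icc]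
    intro t ht
    simp only [mem_Icc, β] at ht
    exact ⟨by linarith [ht.1], by linarith [ht.2]⟩
  have hint : ∀ θ : ℝ → ℝ, Continuous θ → HasCompactSupport θ →
      IntegrableOn (fun t => θ t • P t) (Ioo 0 T) := fun θ h1 h2 => by
    obtain ⟨C, hC⟩ := h2.exists_bound_of_continuous h1
    exact hP.bdd_smul C h1.aestronglyMeasurable (ae_of_all _ hC)
  have hc₀ : HasCompactSupport θ₀ := β.hasCompactSupport_normed
  have hd₀ : ContDiff ℝ ∞ θ₀ := β.contDiff_normed
  refine ⟨∫ t in Ioo 0 T, θ₀ t • P t, ?_⟩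
  set c := ∫ t in Ioo 0 T, θ₀ t • P t with hc
  have key : ∀ᵐ t, t ∈ Ioo 0 T → P t - c = 0 := by
    refine isOpen_Ioo.ae_eq_zero_of_integral_contDiff_smul_eq_zero
      ((hP.sub (integrableOn_const (by simp))).locallyIntegrableOn)
      fun θ h1 h2 h3 => ?_
    -- Subtracting `m * θ₀` removes the mean of `θ`, so the difference is the derivative of an
    -- admissible function; hence `∫ θ P = m c = ∫ θ c`.
    set m := ∫ t, θ t with hm
    have h4 : tsupport (fun t => θ t - m * θ₀ t) ⊆ Ioo 0 T := by
      refine (tsupport_sub θ (fun t => m * θ₀ t)).trans (union_subset h3 ?_)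
      exact (closure_mono (Function.support_mul_subset_right _ _)).trans hs₀
    obtain ⟨Θ, a1, a2, a3, a4⟩ := exists_deriv_eq_of_integral_eq_zero
      (φ := fun t => θ t - m * θ₀ t) (h1.sub (contDiff_const.mul hd₀))
      (HasCompactSupport.sub h2 (HasCompactSupport.mul_left hc₀)) h4 (by
        rw [integral_sub (h1.continuous.integrable_of_hasCompactSupport h2)
          ((hd₀.continuous.integrable_of_hasCompactSupport hc₀).const_mul m),
          integral_const_mul, hθ₀, β.integral_normed, mul_one, sub_self])
    have h5 := H Θ a1 a2 a3
    rw [a4] at h5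
    simp only [sub_smul, mul_smul] at h5
    have h8 : IntegrableOn (fun t => m • θ₀ t • P t) (Ioo 0 T) :=
      (hint θ₀ hd₀.continuous hc₀).smul m
    rw [integral_sub (hint θ h1.continuous h2) h8, integral_smul] at h5
    have h6 : ∫ t in Ioo 0 T, θ t • (P t - c) = ∫ t, θ t • (P t - c) :=
      setIntegral_eq_integral_of_forall_compl_eq_zero fun t ht => by
        rw [image_eq_zero_of_notMem_tsupport fun h => ht (h3 h), zero_smul]
    have h7 : ∫ t in Ioo 0 T, θ t = m :=
      setIntegral_eq_integral_of_forall_compl_eq_zero fun t ht =>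
        image_eq_zero_of_notMem_tsupport fun h => ht (h3 h)
    rw [← h6]
    simp only [smul_sub]
    rw [integral_sub (hint θ h1.continuous h2)
      ((h1.continuous.integrable_of_hasCompactSupport h2).integrableOn.smul_const c),
      integral_smul_const, h7]
    exact h5
  rw [ae_restrict_iff' measurableSet_Ioo]
  filter_upwards [key] with t ht h
  exact sub_eq_zero.1 (ht h)

/-- A function with an integrable weak time derivative is a.e. a primitive of it. -/
theorem exists_ae_eq_primitive_of_weak_deriv {T : ℝ} (hT : 0 < T) {f f' : ℝ → E}
    (hf : IntegrableOn f (Ioo 0 T)) (hf' : IntegrableOn f' (Ioo 0 T))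
    (H : ∀ θ : ℝ → ℝ, ContDiff ℝ ∞ θ → HasCompactSupport θ → tsupport θ ⊆ Ioo 0 T →
      ∫ t in Ioo 0 T, deriv θ t • f t = - ∫ t in Ioo 0 T, θ t • f' t) :
    ∃ c : E, ∀ᵐ t ∂(timeMeasure T),
      f t = c + ∫ s in (0 : ℝ)..t, (Ioo 0 T).indicator f' s := by
  set F := (Ioo 0 T).indicator f' with hF
  have hFi : Integrable F := (integrable_indicator_iff measurableSet_Ioo).2 hf'
  set G : ℝ → E := fun t => ∫ s in (0 : ℝ)..t, F s with hG
  have hGc : Continuous G := intervalIntegral.continuous_primitive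
    (fun _ _ => hFi.intervalIntegrable) 0
  have hGi : IntegrableOn G (Ioo 0 T) :=
    (hGc.integrableOn_Icc (a := 0) (b := T)).mono_set Ioo_subset_Icc_self
  obtain ⟨c, hc⟩ := exists_ae_eq_const_of_integral_deriv_smul_eq_zero hT (hf.sub hGi)
    fun θ h1 h2 h3 => by
      have hb := h2.deriv.exists_bound_of_continuous (h1.continuous_deriv (by simp))
      obtain ⟨C, hC⟩ := hb
      have hm : AEStronglyMeasurable (deriv θ) (timeMeasure T) :=
        (h1.continuous_deriv (by simp)).aestronglyMeasurable
      have hi1 : IntegrableOn (fun t => deriv θ t • f t) (Ioo 0 T) :=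
        hf.bdd_smul C hm (ae_of_all _ hC)
      have hi2 : IntegrableOn (fun t => deriv θ t • G t) (Ioo 0 T) :=
        hGi.bdd_smul C hm (ae_of_all _ hC)
      simp only [Pi.sub_apply, smul_sub]
      rw [integral_sub hi1 hi2, H θ h1 h2 h3]
      have e1 : ∫ t in Ioo 0 T, deriv θ t • G t = ∫ t, deriv θ t • G t :=
        setIntegral_eq_integral_of_forall_compl_eq_zero fun t ht => by
          rw [image_eq_zero_of_notMem_tsupport fun h => ht (h3 (tsupport_deriv_subset h)),
            zero_smul]
      have e2 : ∫ t in Ioo 0 T, θ t • f' t = ∫ t, θ t • F t := by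
        rw [← integral_indicator measurableSet_Ioo]
        congr 1
        ext t
        rw [hF, indicator_smul_apply]
      rw [e1, e2, integral_deriv_smul_primitive hFi h1 h2, sub_self]
  refine ⟨c, ?_⟩
  filter_upwards [hc] with t ht
  rw [← ht]
  simp [hG]

end TimeDerivative

/-! ### Decrease of a functional along an absolutely continuous curve. -/

section Energy

variable {E : Type*} [NormedAddCommGroup E] [InnerProductSpace ℝ E] [CompleteSpace E]

local notation "⟪" x ", " y "⟫" => inner ℝ x y

/-- A functional with quadratically controlled first order expansion decreases along a primitive
whose derivative makes a nonpositive product with the gradient. -/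
theorem le_of_ae_inner_gradient_nonpos {ψ : E → ℝ} {K : E → E}
    (hψ : ∀ v a, |ψ v - ψ a - ⟪K a, v - a⟫| ≤ ‖v - a‖ ^ 2) (hK : ∀ a, ‖K a‖ ≤ ‖a‖)
    {F : ℝ → E} (hF : Integrable F) (c : E) {t : ℝ} (ht : 0 ≤ t)
    (H : ∀ᵐ s, s ∈ Ioc 0 t → ⟪K (c + ∫ r in (0 : ℝ)..s, F r), F s⟫ ≤ 0) :
    ψ (c + ∫ r in (0 : ℝ)..t, F r) ≤ ψ c := by
  set w : ℝ → E := fun s => c + ∫ r in (0 : ℝ)..s, F r with hw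
  set R := ‖c‖ + ∫ r, ‖F r‖ with hR
  have hwR : ∀ s, ‖w s‖ ≤ R := fun s => by
    refine (norm_add_le _ _).trans (add_le_add_right ?_ _)
    refine intervalIntegral.norm_integral_le_integral_norm_uIoc.trans ?_
    exact setIntegral_le_integral hF.norm (ae_of_all _ fun _ => norm_nonneg _)
  have hd : ∀ a, HasFDerivAt ψ (innerSL ℝ (K a)) a := fun a => by
    rw [hasFDerivAt_iff_isLittleO]
    refine Asymptotics.IsBigO.trans_isLittleO (g := fun v => ‖v - a‖ ^ 2)
      (Asymptotics.IsBigO.of_bound 1 (Eventually.of_forall fun v => ?_)) ?_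
    · simpa using hψ v a
    · exact (Asymptotics.isLittleO_pow_sub_sub a one_lt_two)
  -- The curve stays in the ball of radius `R`: the quadratic remainder is at most `2 * R * ‖w x - w
  -- y‖` and the linear term at most `R * ‖w x - w y‖`, which gives the constant `3 * R`.
  have hAC : AbsolutelyContinuousOnInterval (fun s => ψ (w s)) 0 t := by
    refine absolutelyContinuousOnInterval_of_dist_le (C := 3 * R)
      (hF.norm.intervalIntegrable.absolutelyContinuousOnInterval_intervalIntegral
        (c := 0) left_mem_uIcc) fun x y => ?_
    have h1 := hψ (w x) (w y)
    have h2 : ‖w x - w y‖ ≤ dist (∫ s in (0 : ℝ)..x, ‖F s‖) (∫ s in (0 : ℝ)..y, ‖F s‖) := by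
      have := dist_primitive_le hF 0 x y
      rw [dist_eq_norm] at this
      simpa [hw] using this
    have h3 : |⟪K (w y), w x - w y⟫| ≤ R * ‖w x - w y‖ :=
      (abs_real_inner_le_norm _ _).trans
        (mul_le_mul_of_nonneg_right ((hK _).trans (hwR y)) (norm_nonneg _))
    have h4 : ‖w x - w y‖ ≤ 2 * R := by
      linarith [norm_sub_le (w x) (w y), hwR x, hwR y]
    have hR0 : 0 ≤ R := (norm_nonneg _).trans (hwR 0)
    rw [Real.dist_eq]
    calc |ψ (w x) - ψ (w y)|
        ≤ |ψ (w x) - ψ (w y) - ⟪K (w y), w x - w y⟫| + |⟪K (w y), w x - w y⟫| := by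
          simpa using abs_add_le (ψ (w x) - ψ (w y) - ⟪K (w y), w x - w y⟫)
            ⟪K (w y), w x - w y⟫
      _ ≤ ‖w x - w y‖ ^ 2 + R * ‖w x - w y‖ := add_le_add h1 h3
      _ ≤ 3 * R * ‖w x - w y‖ := by nlinarith [norm_nonneg (w x - w y)]
      _ ≤ _ := by gcongr
  have hfin := hAC.integral_deriv_eq_sub
  have hle : ∫ s in (0 : ℝ)..t, deriv (fun s => ψ (w s)) s ≤ 0 := by
    rw [intervalIntegral.integral_of_le ht]
    refine setIntegral_nonpos_of_ae_restrict ?_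
    rw [EventuallyLE, ae_restrict_iff' measurableSet_Ioc]
    filter_upwards [H, LocallyIntegrable.ae_hasDerivAt_integral hF.locallyIntegrable] with s h1 h2 hs
    have h3 : HasDerivAt w (F s) s := (h2 0).const_add c
    have h4 := (hd (w s)).comp_hasDerivAt s h3
    have h5 : deriv (fun s => ψ (w s)) s = ⟪K (w s), F s⟫ := h4.deriv
    rw [h5]
    exact h1 hs
  rw [hfin] at hle
  have : w 0 = c := by simp [hw]
  rw [this] at hle
  linarith

end Energy

/-! ### The penalty function and the functional it induces on `L²(U)`. -/

section Penalty

/-- The second derivative of the penalty function for the constraint `0 ≤ s ≤ 1`. -/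
def penaltySlope (s : ℝ) : ℝ := min 1 (max 0 (max (-s) (s - 1)))

/-- The derivative of the penalty function for the constraint `0 ≤ s ≤ 1`. -/
def penaltyDeriv (s : ℝ) : ℝ := ∫ r in (0 : ℝ)..s, penaltySlope r

/-- A convex `C²` penalty function that vanishes exactly on `[0, 1]`. -/
def penalty (s : ℝ) : ℝ := ∫ r in (0 : ℝ)..s, penaltyDeriv r

/-- Continuity of the slope lets the `C¹` chain rule apply to `penaltyDeriv`, unlike a truncation
such as the positive part. The cap at `1` makes `penaltyDeriv` Lipschitz, so that it acts on
`L²(U)`. -/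
theorem continuous_penaltySlope : Continuous penaltySlope := by
  unfold penaltySlope
  fun_prop

theorem penaltySlope_nonneg (s : ℝ) : 0 ≤ penaltySlope s :=
  le_min zero_le_one (le_max_left _ _)

theorem norm_penaltySlope_le (s : ℝ) : ‖penaltySlope s‖ ≤ 1 := by
  rw [Real.norm_of_nonneg (penaltySlope_nonneg s)]
  exact min_le_left _ _

theorem penaltySlope_eq_zero {s : ℝ} (h0 : 0 ≤ s) (h1 : s ≤ 1) : penaltySlope s = 0 := by
  rw [penaltySlope, max_eq_left (max_le (by linarith) (by linarith)), min_eq_right zero_le_one]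

theorem penaltySlope_pos {s : ℝ} (h : s < 0 ∨ 1 < s) : 0 < penaltySlope s := by
  refine lt_min one_pos (lt_max_of_lt_right ?_)
  rcases h with h | h
  · exact lt_max_of_lt_left (by linarith)
  · exact lt_max_of_lt_right (by linarith)

theorem hasDerivAt_penaltyDeriv (s : ℝ) : HasDerivAt penaltyDeriv (penaltySlope s) s :=
  intervalIntegral.integral_hasDerivAt_right (continuous_penaltySlope.intervalIntegrable _ _)
    continuous_penaltySlope.aestronglyMeasurable.stronglyMeasurableAtFilter
    continuous_penaltySlope.continuousAt

theorem continuous_penaltyDeriv : Continuous penaltyDeriv :=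
  continuous_iff_continuousAt.2 fun s => (hasDerivAt_penaltyDeriv s).continuousAt

theorem hasDerivAt_penalty (s : ℝ) : HasDerivAt penalty (penaltyDeriv s) s :=
  intervalIntegral.integral_hasDerivAt_right (continuous_penaltyDeriv.intervalIntegrable _ _)
    continuous_penaltyDeriv.aestronglyMeasurable.stronglyMeasurableAtFilter
    continuous_penaltyDeriv.continuousAt

theorem continuous_penalty : Continuous penalty :=
  continuous_iff_continuousAt.2 fun s => (hasDerivAt_penalty s).continuousAt

theorem penaltyDeriv_zero : penaltyDeriv 0 = 0 := by simp [penaltyDeriv]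

theorem penalty_zero : penalty 0 = 0 := by simp [penalty]

theorem penaltyDeriv_eq_zero {s : ℝ} (h0 : 0 ≤ s) (h1 : s ≤ 1) : penaltyDeriv s = 0 := by
  rw [penaltyDeriv, intervalIntegral.integral_congr (g := fun _ => 0)]
  · simp
  · intro x hx
    rw [uIcc_of_le h0] at hx
    exact penaltySlope_eq_zero hx.1 (hx.2.trans h1)

theorem penalty_eq_zero {s : ℝ} (h0 : 0 ≤ s) (h1 : s ≤ 1) : penalty s = 0 := by
  rw [penalty, intervalIntegral.integral_congr (g := fun _ => 0)]
  · simp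
  · intro x hx
    rw [uIcc_of_le h0] at hx
    exact penaltyDeriv_eq_zero hx.1 (hx.2.trans h1)

theorem penaltyDeriv_pos {s : ℝ} (h : 1 < s) : 0 < penaltyDeriv s := by
  have : StrictMonoOn penaltyDeriv (Ici 1) :=
    strictMonoOn_of_deriv_pos (convex_Ici 1) continuous_penaltyDeriv.continuousOn fun x hx => by
      rw [(hasDerivAt_penaltyDeriv x).deriv]
      exact penaltySlope_pos (Or.inr (by simpa using hx))
  simpa [penaltyDeriv_eq_zero zero_le_one le_rfl] using
    this self_mem_Ici (mem_Ici.2 h.le) h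

theorem penaltyDeriv_neg {s : ℝ} (h : s < 0) : penaltyDeriv s < 0 := by
  have : StrictMonoOn penaltyDeriv (Iic 0) :=
    strictMonoOn_of_deriv_pos (convex_Iic 0) continuous_penaltyDeriv.continuousOn fun x hx => by
      rw [(hasDerivAt_penaltyDeriv x).deriv]
      exact penaltySlope_pos (Or.inl (by simpa using hx))
  simpa [penaltyDeriv_zero] using this (mem_Iic.2 h.le) self_mem_Iic h

theorem penalty_pos {s : ℝ} (h : s < 0 ∨ 1 < s) : 0 < penalty s := by
  rcases h with h | h
  · have : StrictAntiOn penalty (Iic 0) :=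
      strictAntiOn_of_deriv_neg (convex_Iic 0) continuous_penalty.continuousOn fun x hx => by
        rw [(hasDerivAt_penalty x).deriv]
        exact penaltyDeriv_neg (by simpa using hx)
    simpa [penalty_zero] using this (mem_Iic.2 h.le) self_mem_Iic h
  · have : StrictMonoOn penalty (Ici 1) :=
      strictMonoOn_of_deriv_pos (convex_Ici 1) continuous_penalty.continuousOn fun x hx => by
        rw [(hasDerivAt_penalty x).deriv]
        exact penaltyDeriv_pos (by simpa using hx)
    simpa [penalty_eq_zero zero_le_one le_rfl] using this self_mem_Ici (mem_Ici.2 h.le) h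

theorem penalty_nonneg (s : ℝ) : 0 ≤ penalty s := by
  by_cases h : s < 0 ∨ 1 < s
  · exact (penalty_pos h).le
  · push Not at h
    exact (penalty_eq_zero h.1 h.2).ge

theorem lipschitzWith_penaltyDeriv : LipschitzWith 1 penaltyDeriv :=
  LipschitzWith.of_dist_le_mul fun x y => by
    rw [dist_eq_norm, dist_eq_norm]
    simpa using convex_univ.norm_image_sub_le_of_norm_hasDerivWithin_le
      (fun x _ => (hasDerivAt_penaltyDeriv x).hasDerivWithinAt)
      (fun x _ => norm_penaltySlope_le x) (mem_univ y) (mem_univ x)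

/-- The mean value inequality for `x ↦ penalty x - penaltyDeriv a * x`, whose derivative between `a`
and `v` is at most `|v - a|` because `penaltyDeriv` is 1-Lipschitz. -/
theorem abs_penalty_sub_le (v a : ℝ) :
    |penalty v - penalty a - penaltyDeriv a * (v - a)| ≤ (v - a) ^ 2 := by
  have h := (convex_uIcc a v).norm_image_sub_le_of_norm_hasDerivWithin_le (C := |v - a|)
    (f := fun x => penalty x - penaltyDeriv a * x) (f' := fun x => penaltyDeriv x - penaltyDeriv a)
    (fun x _ => ((hasDerivAt_penalty x).sub
      (by simpa using (hasDerivAt_id x).const_mul (penaltyDeriv a))).hasDerivWithinAt)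
    (fun x hx => by
      have h1 := lipschitzWith_penaltyDeriv.dist_le_mul x a
      rw [dist_eq_norm, dist_eq_norm] at h1
      have h2 : |x - a| ≤ |v - a| := abs_sub_left_of_mem_uIcc hx
      simp only [NNReal.coe_one, one_mul, Real.norm_eq_abs] at h1 ⊢
      exact h1.trans h2) left_mem_uIcc right_mem_uIcc
  simp only [Real.norm_eq_abs] at h
  rw [abs_mul_abs_self, ← sq] at h
  refine le_of_eq_of_le ?_ h
  congr 1
  ring

variable {U : Set Plane}

/-- The penalty functional on `L²(U)`. -/
def penaltyFunctional (v : L2 U) : ℝ := ∫ x in U, penalty (v x)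

/-- The gradient of the penalty functional. -/
def penaltyGradient (v : L2 U) : L2 U :=
  lipschitzWith_penaltyDeriv.compLp penaltyDeriv_zero v

theorem coeFn_penaltyGradient (v : L2 U) :
    ∀ᵐ x ∂(volume.restrict U), penaltyGradient v x = penaltyDeriv (v x) :=
  lipschitzWith_penaltyDeriv.coeFn_compLp penaltyDeriv_zero v

theorem norm_penaltyGradient_le (v : L2 U) : ‖penaltyGradient v‖ ≤ ‖v‖ := by
  have := lipschitzWith_penaltyDeriv.norm_compLp_le penaltyDeriv_zero v
  rwa [NNReal.coe_one, one_mul] at this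

theorem integrable_penalty (v : L2 U) :
    Integrable (fun x => penalty (v x)) (volume.restrict U) := by
  refine (Lp.memLp v).integrable_sq.mono'
    (continuous_penalty.comp_aestronglyMeasurable (Lp.aestronglyMeasurable _))
    (ae_of_all _ fun x => ?_)
  simpa [penalty_zero, penaltyDeriv_zero] using abs_penalty_sub_le (v x) 0

/-- The scalar bound is uniform in its base point and quadratic, so it integrates directly to a
Fréchet expansion on `L²(U)`. -/
theorem abs_penaltyFunctional_sub_le (v a : L2 U) :
    |penaltyFunctional v - penaltyFunctional a - inner ℝ (penaltyGradient a) (v - a)| ≤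
      ‖v - a‖ ^ 2 := by
  have h1 : ‖v - a‖ ^ 2 = ∫ x in U, (v x - a x) ^ 2 := by
    rw [← real_inner_self_eq_norm_sq, L2.inner_def]
    refine integral_congr_ae ?_
    filter_upwards [Lp.coeFn_sub v a] with x hx
    rw [hx, Pi.sub_apply, real_inner_self_eq_norm_sq, Real.norm_eq_abs, sq_abs]
  have h2 : inner ℝ (penaltyGradient a) (v - a) =
      ∫ x in U, penaltyDeriv (a x) * (v x - a x) := by
    rw [L2.inner_def]
    refine integral_congr_ae ?_
    filter_upwards [Lp.coeFn_sub v a, coeFn_penaltyGradient a] with x hx hx'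
    rw [hx, hx', Pi.sub_apply, real_inner_comm, RCLike.inner_apply, conj_trivial]
  have h3 : Integrable (fun x => penaltyDeriv (a x) * (v x - a x)) (volume.restrict U) := by
    refine (L2.integrable_inner (𝕜 := ℝ) (penaltyGradient a) (v - a)).congr ?_
    filter_upwards [Lp.coeFn_sub v a, coeFn_penaltyGradient a] with x hx hx'
    rw [hx, hx', Pi.sub_apply, real_inner_comm, RCLike.inner_apply, conj_trivial]
  have h4 : Integrable (fun x => (v x - a x) ^ 2) (volume.restrict U) :=
    ((Lp.memLp v).sub (Lp.memLp a)).integrable_sq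
  have h5 : Integrable (fun x => penalty (v x) - penalty (a x)) (volume.restrict U) :=
    (integrable_penalty v).sub (integrable_penalty a)
  rw [h1, h2, penaltyFunctional, penaltyFunctional,
    ← integral_sub (integrable_penalty v) (integrable_penalty a),
    ← integral_sub h5 h3]
  rw [← Real.norm_eq_abs]
  exact norm_integral_le_of_norm_le h4 (ae_of_all _ fun x => abs_penalty_sub_le (v x) (a x))

theorem penaltyFunctional_nonneg (v : L2 U) : 0 ≤ penaltyFunctional v :=
  integral_nonneg fun _ => penalty_nonneg _

theorem penaltyFunctional_eq_zero_iff {v : L2 U} :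
    penaltyFunctional v = 0 ↔ ∀ᵐ x ∂(volume.restrict U), 0 ≤ v x ∧ v x ≤ 1 := by
  rw [penaltyFunctional, integral_eq_zero_iff_of_nonneg (fun _ => penalty_nonneg _)
    (integrable_penalty v)]
  refine eventually_congr (ae_of_all _ fun x => ⟨fun h => ?_, fun h => penalty_eq_zero h.1 h.2⟩)
  by_contra hn
  refine (penalty_pos (s := v x) ?_).ne' h
  by_contra h'
  push Not at h'
  exact hn h'

end Penalty

/-! ### A countable determining family of test functions. -/

section TestFunctions

/-- A countable family of test functions detects integrable functions on `U`. -/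
theorem exists_countable_isTestFunction {U : Set Plane} (hU : IsOpen U)
    (hUb : Bornology.IsBounded U) :
    ∃ D : Set (Plane → ℝ), D.Countable ∧ (∀ ξ ∈ D, IsTestFunction U ξ) ∧
      ∀ F : Plane → ℝ, IntegrableOn F U → (∀ ξ ∈ D, ∫ x in U, F x * ξ x = 0) →
        ∀ᵐ x ∂(volume.restrict U), F x = 0 := by
  have hK : IsCompact (closure U) := hUb.isCompact_closure
  have : CompactSpace (closure U) := isCompact_iff_compactSpace.1 hK
  -- Since `closure U` is compact, `C(closure U, ℝ)` is separable, and a subset of it has a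
  -- countable subset that is dense in it for the uniform norm.
  set S : Set C(closure U, ℝ) := {φ | ∃ ξ, IsTestFunction U ξ ∧ ∀ x, φ x = ξ x} with hS
  obtain ⟨t, htS, htc, htd⟩ :=
    ((TopologicalSpace.IsSeparable.of_separableSpace (univ : Set C(closure U, ℝ))).mono
      (subset_univ S)).exists_countable_dense_subset
  have htS' : ∀ φ ∈ t, ∃ ξ, IsTestFunction U ξ ∧ ∀ x, φ x = ξ x := fun φ hφ => htS hφ
  choose! e he using htS'
  refine ⟨e '' t, htc.image e, ?_, fun F hF hD => ?_⟩
  · rintro _ ⟨φ, hφ, rfl⟩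
    exact (he φ hφ).1
  have hall : ∀ ξ, IsTestFunction U ξ → ∫ x in U, F x * ξ x = 0 := fun ξ hξ => by
    have hint : ∀ ζ : Plane → ℝ, IsTestFunction U ζ → IntegrableOn (fun x => F x * ζ x) U :=
      fun ζ hζ => by
        obtain ⟨C, hC⟩ := hζ.hasCompactSupport.exists_bound_of_continuous hζ.smooth.continuous
        exact hF.mul_bdd (c := C) hζ.smooth.continuous.aestronglyMeasurable (ae_of_all _ hC)
    rw [← norm_le_zero_iff]
    refine le_of_forall_pos_le_add fun r hr => ?_
    set I := ∫ x in U, ‖F x‖ with hI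
    have hI0 : 0 ≤ I := integral_nonneg fun _ => norm_nonneg _
    let φ : C(closure U, ℝ) := ⟨fun x => ξ x, hξ.smooth.continuous.comp continuous_subtype_val⟩
    -- The tolerance makes the error `I * (r / (I + 1)) ≤ r`; the `+ 1` covers `I = 0`.
    obtain ⟨χ, hχ, hd⟩ := Metric.mem_closure_iff.1 (htd ⟨ξ, hξ, fun _ => rfl⟩ : φ ∈ closure t)
      (r / (I + 1)) (by positivity)
    have h1 := hD (e χ) (mem_image_of_mem e hχ)
    have h2 : ∫ x in U, F x * ξ x = ∫ x in U, (F x * ξ x - F x * e χ x) := by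
      rw [integral_sub (hint ξ hξ) (hint _ (he χ hχ).1), h1, sub_zero]
    rw [h2, zero_add]
    calc ‖∫ x in U, (F x * ξ x - F x * e χ x)‖
        ≤ ∫ x in U, ‖F x‖ * (r / (I + 1)) := by
          refine norm_integral_le_of_norm_le (hF.norm.mul_const _) ?_
          refine (ae_restrict_iff' hU.measurableSet).2 (ae_of_all _ fun x hx => ?_)
          rw [← mul_sub, norm_mul]
          refine mul_le_mul_of_nonneg_left ?_ (norm_nonneg _)
          have h3 := (φ.dist_apply_le_dist (g := χ) ⟨x, subset_closure hx⟩).trans hd.le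
          rw [(he χ hχ).2, dist_eq_norm] at h3
          exact h3
      _ = I * (r / (I + 1)) := integral_mul_const _ _
      _ ≤ r := by
          rw [mul_div_assoc', div_le_iff₀ (by positivity)]
          nlinarith
  have := hU.ae_eq_zero_of_integral_contDiff_smul_eq_zero (μ := volume) (f := F)
    hF.locallyIntegrableOn fun ξ h1 h2 h3 => by
      have h4 := hall ξ ⟨h1, h2, h3⟩
      rw [setIntegral_eq_integral_of_forall_compl_eq_zero fun x hx => by
        rw [image_eq_zero_of_notMem_tsupport fun h => hx (h3 h), mul_zero]] at h4
      simpa [mul_comm] using h4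
  exact (ae_restrict_iff' hU.measurableSet).2 this

end TestFunctions

/-! ### From the weak formulation to the equation almost everywhere. -/

section PointwiseEquation

/-- By continuity the identity extends to all of `[0, T]`. Time `0` yields `p`, and Lebesgue
differentiation yields `q`. This separates the initial condition from the evolution equation. -/
theorem eq_zero_of_ae_add_primitive_eq_zero {T : ℝ} (hT : 0 < T) {p : ℝ} {q : ℝ → ℝ}
    (hq : IntegrableOn q (Ioo 0 T))
    (h : ∀ᵐ t ∂(timeMeasure T), p + ∫ s in (0 : ℝ)..t, q s = 0) :
    p = 0 ∧ ∀ᵐ t ∂(timeMeasure T), q t = 0 := by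
  set Q := (Ioo 0 T).indicator q with hQ
  have hQi : Integrable Q := (integrable_indicator_iff measurableSet_Ioo).2 hq
  have hQc : Continuous fun t => p + ∫ s in (0 : ℝ)..t, Q s :=
    continuous_const.add (intervalIntegral.continuous_primitive
      (fun _ _ => hQi.intervalIntegrable) 0)
  have hQq : ∀ t ∈ Ioo 0 T, ∫ s in (0 : ℝ)..t, Q s = ∫ s in (0 : ℝ)..t, q s := fun t ht => by
    refine intervalIntegral.integral_congr_ae (ae_of_all _ fun s hs => ?_)
    rw [uIoc_of_le ht.1.le] at hs
    exact indicator_of_mem (show s ∈ Ioo 0 T from ⟨hs.1, hs.2.trans_lt ht.2⟩) q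
  have hall : EqOn (fun t => p + ∫ s in (0 : ℝ)..t, Q s) (fun _ => 0) (Icc 0 T) := by
    refine Measure.eqOn_Icc_of_ae_eq volume hT.ne ?_ hQc.continuousOn continuousOn_const
    rw [Measure.restrict_congr_set Ioo_ae_eq_Icc.symm]
    filter_upwards [h, ae_restrict_mem measurableSet_Ioo] with t ht htT
    rw [hQq t htT]
    exact ht
  have hp : p = 0 := by simpa using hall (left_mem_Icc.2 hT.le)
  refine ⟨hp, ?_⟩
  rw [ae_restrict_iff' measurableSet_Ioo]
  filter_upwards [LocallyIntegrable.ae_hasDerivAt_integral hQi.locallyIntegrable] with t h1 ht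
  have h2 : HasDerivAt (fun t => ∫ s in (0 : ℝ)..t, Q s) 0 t := by
    refine (hasDerivAt_const t (0 : ℝ)).congr_of_eventuallyEq ?_
    filter_upwards [Icc_mem_nhds ht.1 ht.2] with s hs
    simpa [hp] using hall hs
  rw [← (h1 0).unique h2, hQ, indicator_of_mem ht]

variable {U : Set Plane}

theorem inner_toLp_eq_integral {k : Plane → ℝ}
    (hk : MemLp k 2 ((volume : Measure Plane).restrict U)) (f : L2 U) :
    inner ℝ hk.toLp f = ∫ x in U, f x * k x := by
  rw [L2.inner_def]
  refine integral_congr_ae ?_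
  filter_upwards [hk.coeFn_toLp] with x hx
  rw [hx, RCLike.inner_apply, conj_trivial]

theorem H2.integral_sum_d_mul_pd (v : H2 U) {ξ : Plane → ℝ} (hξ : IsTestFunction U ξ) :
    ∫ x in U, ∑ i, v.toH1.d i x * pd i ξ x = - ∫ x in U, v.laplacian x * ξ x := by
  rw [integral_finsetSum _ fun i _ => integrable_L2_mul _ (hξ.memLp_pd i),
    ← inner_toLp_eq_integral hξ.memLp, H2.laplacian, inner_sum, ← Finset.sum_neg_distrib]
  refine Finset.sum_congr rfl fun i _ => ?_
  rw [inner_toLp_eq_integral]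
  exact v.2.2 i i ξ hξ

/-- The weak partial derivative `∂ᵢ` as a continuous linear map `H¹(U) → L²(U)`. -/
def H1.dCLM (i : Fin 2) : H1 U →L[ℝ] L2 U :=
  (ContinuousLinearMap.proj i).comp
    ((ContinuousLinearMap.snd ℝ (L2 U) (Fin 2 → L2 U)).comp (sobolevH1 U).subtypeL)

theorem integrable_sum_sq_d (v : H1 U) :
    Integrable (fun x => ∑ i, (v.d i x) ^ 2) (volume.restrict U) :=
  integrable_finsetSum _ fun i _ => (Lp.memLp (v.d i)).integrable_sq

/-- Strong solutions satisfy the second equation almost everywhere. -/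
theorem IsStrongSolution.exists_primitive (hU : IsOpen U) (hUb : Bornology.IsBounded U)
    {T ε η : ℝ} (hT : 0 < T) {a b : ℝ → ℝ} {g u₀ z₀ : L2 U} {u z : ℝ → H2 U}
    (h : IsStrongSolution U T ε η a b g u₀ z₀ u z) (hb : Continuous b) {M : ℝ}
    (hM : ∀ s, ‖b s‖ ≤ M) :
    ∃ F : ℝ → L2 U, Integrable F ∧
      (∀ᵐ t ∂(timeMeasure T), (z t).fn = z₀ + ∫ s in (0 : ℝ)..t, F s) ∧
      ∀ᵐ t ∂(timeMeasure T), ∀ᵐ x ∂(volume.restrict U),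
        F t x = 2 * ε * (z t).laplacian x - b ((z t).fn x) * (∑ i, ((u t).toH1.d i x) ^ 2) +
          (1 - (z t).fn x) / (2 * ε) := by
  have hfin : IsFiniteMeasure ((volume : Measure Plane).restrict U) :=
    ⟨by simpa using hUb.measure_lt_top⟩
  obtain ⟨hf, f', hf', hff'⟩ := h.z_H1_L2
  have hfi : IntegrableOn (fun t => (z t).fn) (Ioo 0 T) := hf.integrable (by norm_num)
  have hfi' : IntegrableOn f' (Ioo 0 T) := hf'.integrable (by norm_num)
  obtain ⟨c, hc⟩ := exists_ae_eq_primitive_of_weak_deriv hT hfi hfi' hff'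
  set F := (Ioo 0 T).indicator f' with hF
  have hFi : Integrable F := (integrable_indicator_iff measurableSet_Ioo).2 hfi'
  have hW := h.isWeakSolution
  -- For fixed `ξ`, the tested equation is subtracted from the tested representation `z = c + ∫ F`.
  -- The exceptional set of times still depends on `ξ`.
  have hpair : ∀ ξ, IsTestFunction U ξ → (∫ x in U, (c - z₀) x * ξ x = 0) ∧
      ∀ᵐ t ∂(timeMeasure T), (∫ x in U, F t x * ξ x) +
        (∫ x in U, 2 * ε * ∑ i, (z t).toH1.d i x * pd i ξ x) +
        (∫ x in U, reactionTerm b (u t).toH1 (z t).toH1 ξ x) -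
        (∫ x in U, (1 - (z t).fn x) / (2 * ε) * ξ x) = 0 := fun ξ hξ => by
    set e : L2 U := hξ.memLp.toLp with he
    have hee : ∀ v : L2 U, ∫ x in U, v x * ξ x = inner ℝ e v := fun v =>
      (inner_toLp_eq_integral hξ.memLp v).symm
    have i0 : Integrable fun t => inner ℝ e (F t) := hFi.const_inner e
    have i1 : IntegrableOn (fun t => ∫ x in U, 2 * ε * ∑ i, (z t).toH1.d i x * pd i ξ x)
        (Ioo 0 T) := by
      have e1 : ∀ t, ∫ x in U, 2 * ε * ∑ i, (z t).toH1.d i x * pd i ξ x =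
          2 * ε * ∑ i, inner ℝ (hξ.memLp_pd i).toLp (H1.dCLM i (z t).toH1) := fun t => by
        rw [integral_const_mul,
          integral_finsetSum _ fun i _ => integrable_L2_mul _ (hξ.memLp_pd i)]
        simp only [inner_toLp_eq_integral]
        rfl
      simp only [e1]
      have hz1 : IntegrableOn (fun t => (z t).toH1) (Ioo 0 T) :=
        hW.z_L2_H1.integrable (by norm_num)
      exact (integrable_finsetSum _ fun i _ =>
        ((H1.dCLM i).integrable_comp hz1).const_inner _).const_mul _
    have i2 := (hW.integrable_reaction ξ hξ).2
    have i3 : IntegrableOn (fun t => ∫ x in U, (1 - (z t).fn x) / (2 * ε) * ξ x) (Ioo 0 T) := by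
      have e3 : ∀ t, ∫ x in U, (1 - (z t).fn x) / (2 * ε) * ξ x =
          (1 / (2 * ε)) * ((∫ x in U, ξ x) - inner ℝ e (z t).fn) := fun t => by
        rw [← hee, ← integral_sub (hξ.memLp.integrable (by norm_num))
          (integrable_L2_mul _ hξ.memLp), ← integral_const_mul]
        refine integral_congr_ae (ae_of_all _ fun x => ?_)
        ring
      simp only [e3]
      exact ((integrable_const _).sub (hfi.const_inner e)).const_mul _
    simp only [hee]
    refine eq_zero_of_ae_add_primitive_eq_zero hT
      (((i0.integrableOn.add i1).add i2).sub i3) ?_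
    filter_upwards [hc, hW.z_equation, ae_restrict_mem measurableSet_Ioo] with t h1 h2 ht
    have hsub : Ioc 0 t ⊆ Ioo 0 T := fun s hs => ⟨hs.1, hs.2.trans_lt ht.2⟩
    have hI : ∀ {q : ℝ → ℝ}, IntegrableOn q (Ioo 0 T) → IntervalIntegrable q volume 0 t :=
      fun hq => (intervalIntegrable_iff_integrableOn_Ioc_of_le ht.1.le).2 (hq.mono_set hsub)
    have h3 := h2 ξ hξ
    rw [hee, hee] at h3
    have h4 : inner ℝ e (z t).toH1.fn = inner ℝ e c + ∫ s in (0 : ℝ)..t, inner ℝ e (F s) := by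
      have : (z t).toH1.fn = c + ∫ s in (0 : ℝ)..t, F s := h1
      rw [this, inner_add_right]
      congr 1
      exact ((innerSL ℝ e).intervalIntegral_comp_comm hFi.intervalIntegrable).symm
    rw [intervalIntegral.integral_sub ((hI i0.integrableOn).add (hI i1) |>.add (hI i2)) (hI i3),
      intervalIntegral.integral_add ((hI i0.integrableOn).add (hI i1)) (hI i2),
      intervalIntegral.integral_add (hI i0.integrableOn) (hI i1), inner_sub_right]
    have h5 : (fun s => ∫ x in U, (1 - (z s).toH1.fn x) / (2 * ε) * ξ x) =
      fun s => ∫ x in U, (1 - (z s).fn x) / (2 * ε) * ξ x := rfl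
    rw [h5] at h3
    linarith
  obtain ⟨D, hDc, hDt, hD⟩ := exists_countable_isTestFunction hU hUb
  have hcz : c = z₀ := by
    rw [← sub_eq_zero]
    refine Lp.ext ?_
    filter_upwards [hD (fun x => (c - z₀ : L2 U) x) ((Lp.memLp (c - z₀)).integrable (by norm_num))
      fun ξ hξ => (hpair ξ (hDt ξ hξ)).1, Lp.coeFn_zero ℝ 2 (volume.restrict U)] with x h1 h2
    rw [h1, h2]; rfl
  refine ⟨F, hFi, hcz ▸ hc, ?_⟩
  -- Countability of `D` yields one null set of times valid for all `ξ ∈ D`, and `D` suffices to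
  -- identify the integrand.
  have hae := (ae_ball_iff hDc).2 fun ξ hξ => (hpair ξ (hDt ξ hξ)).2
  filter_upwards [hae] with t ht
  have hi : ∀ v : L2 U, Integrable v (volume.restrict U) := fun v =>
    (Lp.memLp v).integrable (by norm_num)
  have j2 : Integrable (fun x => b ((z t).fn x) * ∑ i, ((u t).toH1.d i x) ^ 2)
      (volume.restrict U) :=
    (integrable_sum_sq_d _).bdd_mul (c := M)
      (hb.comp_aestronglyMeasurable (Lp.aestronglyMeasurable _)) (ae_of_all _ fun x => hM _)
  have j3 : Integrable (fun x => (1 - (z t).fn x) / (2 * ε)) (volume.restrict U) :=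
    ((integrable_const _).sub (hi _)).div_const _
  have hfinal := hD (fun x => F t x - 2 * ε * (z t).laplacian x +
    b ((z t).fn x) * (∑ i, ((u t).toH1.d i x) ^ 2) - (1 - (z t).fn x) / (2 * ε))
    ((((hi _).sub ((hi _).const_mul _)).add j2).sub j3) fun ξ hξ => by
      have hξt := hDt ξ hξ
      obtain ⟨C, hC⟩ := hξt.hasCompactSupport.exists_bound_of_continuous hξt.smooth.continuous
      have hmul : ∀ {q : Plane → ℝ}, Integrable q (volume.restrict U) →
          Integrable (fun x => q x * ξ x) (volume.restrict U) := fun hq =>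
        hq.mul_bdd (c := C) hξt.smooth.continuous.aestronglyMeasurable (ae_of_all _ hC)
      have k0 := hmul (hi (F t))
      have k1 : Integrable (fun x => 2 * ε * ((z t).laplacian x * ξ x)) (volume.restrict U) :=
        (hmul (hi _)).const_mul _
      have k2 : Integrable (fun x => reactionTerm b (u t).toH1 (z t).toH1 ξ x)
        (volume.restrict U) := hmul j2
      have k01 : Integrable (fun x => F t x * ξ x - 2 * ε * ((z t).laplacian x * ξ x))
        (volume.restrict U) := k0.sub k1
      have k012 : Integrable (fun x => F t x * ξ x - 2 * ε * ((z t).laplacian x * ξ x) +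
        reactionTerm b (u t).toH1 (z t).toH1 ξ x) (volume.restrict U) := k01.add k2
      have h1 := ht ξ hξ
      rw [integral_const_mul, H2.integral_sum_d_mul_pd _ hξt, mul_neg, ← integral_const_mul,
        ← sub_eq_add_neg] at h1
      rw [← h1, ← integral_sub k0 k1, ← integral_add k01 k2, ← integral_sub k012 (hmul j3)]
      refine integral_congr_ae (ae_of_all _ fun x => ?_)
      have : (z t).toH1.fn = (z t).fn := rfl
      simp only [reactionTerm, this]
      ring
  filter_upwards [hfinal] with x hx
  linarith

end PointwiseEquation

/-! ### Properties of the cut-off and signs of the lower-order terms. -/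

section Cutoff

variable {φ : ℝ → ℝ}

theorem IsCutoff.continuous_deriv (hφ : IsCutoff φ) : Continuous (deriv φ) :=
  hφ.smooth.continuous_deriv (by simp)

/-- The endpoints, reached by continuity, matter: `z` may equal `0` or `1` on a set of positive
measure. -/
theorem IsCutoff.eqOn_id (hφ : IsCutoff φ) : EqOn φ id (Icc 0 1) := by
  have h : EqOn φ id (Ioo 0 1) := fun s hs => hφ.eq_self s hs.1 hs.2
  simpa [closure_Ioo zero_ne_one] using h.closure hφ.smooth.continuous continuous_id

theorem IsCutoff.eqOn_deriv (hφ : IsCutoff φ) : EqOn (deriv φ) (fun _ => 1) (Icc 0 1) := by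
  have h : EqOn (deriv φ) (fun _ => 1) (Ioo 0 1) := fun s hs => by
    have : φ =ᶠ[𝓝 s] id := by
      filter_upwards [Ioo_mem_nhds hs.1 hs.2] with r hr using hφ.eq_self r hr.1 hr.2
    rw [this.deriv_eq]
    simp
  simpa [closure_Ioo zero_ne_one] using h.closure hφ.continuous_deriv continuous_const

/-- `φ` is constant off `[-1, 2]`, so `φ' φ` is continuous with compact support. The bound makes the
reaction term integrable over `U`. -/
theorem IsCutoff.exists_norm_deriv_mul_le (hφ : IsCutoff φ) :
    ∃ M, ∀ s, ‖deriv φ s * φ s‖ ≤ M := by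
  have hc : HasCompactSupport fun s => deriv φ s * φ s := by
    refine HasCompactSupport.of_support_subset_isCompact (isCompact_Icc (a := -1) (b := 2))
      fun s hs => ?_
    by_contra hn
    refine hs ?_
    have : deriv φ s = 0 := by
      rcases lt_or_ge s (-1) with h | h
      · have h1 : φ =ᶠ[𝓝 s] fun _ => -1 := by
          filter_upwards [Iio_mem_nhds h] with r hr using hφ.eq_neg_one r (le_of_lt hr)
        rw [h1.deriv_eq]
        simp
      · have h2 : 2 < s := by
          by_contra h2
          exact hn ⟨h, not_lt.1 h2⟩
        have h1 : φ =ᶠ[𝓝 s] fun _ => 2 := by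
          filter_upwards [Ioi_mem_nhds h2] with r hr using hφ.eq_two r (le_of_lt hr)
        rw [h1.deriv_eq]
        simp
    simp [this]
  exact hc.exists_bound_of_continuous (hφ.continuous_deriv.mul hφ.smooth.continuous)

theorem IsCutoff.penaltyDeriv_mul_nonneg (hφ : IsCutoff φ) (s : ℝ) :
    0 ≤ penaltyDeriv s * (deriv φ s * φ s) := by
  have hd : 0 ≤ deriv φ s := hφ.monotone.deriv_nonneg
  rcases lt_or_ge s 0 with h | h
  · have h1 : φ s ≤ 0 := by
      simpa [hφ.eqOn_id (left_mem_Icc.2 zero_le_one)] using hφ.monotone h.le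
    exact mul_nonneg_of_nonpos_of_nonpos (penaltyDeriv_neg h).le
      (mul_nonpos_of_nonneg_of_nonpos hd h1)
  rcases le_or_gt s 1 with h' | h'
  · simp [penaltyDeriv_eq_zero h h']
  · have h1 : 0 ≤ φ s := by
      have := hφ.monotone h'.le
      rw [hφ.eqOn_id (right_mem_Icc.2 zero_le_one)] at this
      exact zero_le_one.trans this
    exact mul_nonneg (penaltyDeriv_pos h').le (mul_nonneg hd h1)

theorem penaltyDeriv_mul_one_sub_nonpos (s : ℝ) : penaltyDeriv s * (1 - s) ≤ 0 := by
  rcases lt_or_ge s 0 with h | h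
  · exact mul_nonpos_of_nonpos_of_nonneg (penaltyDeriv_neg h).le (by linarith)
  rcases le_or_gt s 1 with h' | h'
  · simp [penaltyDeriv_eq_zero h h']
  · exact mul_nonpos_of_nonneg_of_nonpos (penaltyDeriv_pos h').le (by linarith)

end Cutoff

/-! ### The maximum principle and the removal of the cut-off. -/

section MaximumPrinciple

variable {U : Set Plane}

theorem inner_penaltyGradient_nonpos (hU : IsOpen U) (hUb : Bornology.IsBounded U) {ε : ℝ}
    (hε : 0 < ε) {φ : ℝ → ℝ} (hφ : IsCutoff φ) {u z : H2 U} (hz : HasZeroNormalDerivative z)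
    {f : L2 U} (hf : ∀ᵐ x ∂(volume.restrict U), f x = 2 * ε * z.laplacian x -
      deriv φ (z.fn x) * φ (z.fn x) * (∑ i, (u.toH1.d i x) ^ 2) + (1 - z.fn x) / (2 * ε)) :
    inner ℝ (penaltyGradient z.fn) f ≤ 0 := by
  have h1 := hz.integral_laplacian_mul_comp_nonpos hU hUb hasDerivAt_penaltyDeriv
    continuous_penaltySlope norm_penaltySlope_le penaltyDeriv_zero penaltySlope_nonneg
  have hint : Integrable (fun x => z.laplacian x * penaltyDeriv (z.fn x))
      (volume.restrict U) := by
    refine (integrable_L2_mul z.laplacian (Lp.memLp (penaltyGradient z.fn))).congr ?_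
    filter_upwards [coeFn_penaltyGradient z.fn] with x hx
    rw [hx]
  have h2 : ∫ x in U, 2 * ε * (z.laplacian x * penaltyDeriv (z.fn x)) ≤ 0 := by
    rw [integral_const_mul]
    exact mul_nonpos_of_nonneg_of_nonpos (by positivity) h1
  refine le_trans ?_ h2
  rw [L2.inner_def]
  -- The two terms of favourable sign are dropped pointwise, before integrating, so `penaltyDeriv z
  -- * |∇u|²` need not be shown integrable.
  refine integral_mono_ae (L2.integrable_inner _ _) (hint.const_mul _) ?_
  filter_upwards [coeFn_penaltyGradient z.fn, hf] with x hx hfx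
  rw [hx, hfx, RCLike.inner_apply, conj_trivial]
  have a1 := mul_nonneg (hφ.penaltyDeriv_mul_nonneg (z.fn x))
    (Finset.sum_nonneg fun i (_ : i ∈ Finset.univ) => sq_nonneg (u.toH1.d i x))
  have a2 : penaltyDeriv (z.fn x) * (1 - z.fn x) / (2 * ε) ≤ 0 :=
    div_nonpos_of_nonpos_of_nonneg (penaltyDeriv_mul_one_sub_nonpos _) (by positivity)
  calc _ = 2 * ε * (z.laplacian x * penaltyDeriv (z.fn x)) -
        penaltyDeriv (z.fn x) * (deriv φ (z.fn x) * φ (z.fn x)) *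
          (∑ i, (u.toH1.d i x) ^ 2) + penaltyDeriv (z.fn x) * (1 - z.fn x) / (2 * ε) := by ring
    _ ≤ _ := by linarith

/-- The maximum principle for the phase field. -/
theorem IsStrongSolutionCutoff.exists_continuousRepresentative (hU : IsOpen U)
    (hUb : Bornology.IsBounded U) {T ε η : ℝ} (hT : 0 < T) (hε : 0 < ε) {φ : ℝ → ℝ}
    (hφ : IsCutoff φ) {g : L2 U} {u₀ z₀ : H1 U}
    (hz₀ : ∀ᵐ x ∂(volume.restrict U), 0 ≤ z₀.fn x ∧ z₀.fn x ≤ 1) {u z : ℝ → H2 U}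
    (h : IsStrongSolutionCutoff φ U T ε η g u₀ z₀ u z) :
    ∃ w : ℝ → L2 U, IsContinuousRepresentative T (fun t => (z t).fn) w ∧
      ∀ t ∈ Ioo 0 T, ∀ᵐ x ∂(volume.restrict U), 0 ≤ w t x ∧ w t x ≤ 1 := by
  obtain ⟨M, hM⟩ := hφ.exists_norm_deriv_mul_le
  obtain ⟨F, hFi, hF, hFx⟩ := IsStrongSolution.exists_primitive hU hUb hT h
    (hφ.continuous_deriv.mul hφ.smooth.continuous) hM
  refine ⟨fun t => z₀.fn + ∫ s in (0 : ℝ)..t, F s, ⟨?_, ?_⟩, fun t ht => ?_⟩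
  · exact (continuous_const.add (intervalIntegral.continuous_primitive
      (fun _ _ => hFi.intervalIntegrable) 0)).continuousOn
  · filter_upwards [hF] with t ht using ht.symm
  · have key := le_of_ae_inner_gradient_nonpos abs_penaltyFunctional_sub_le
      norm_penaltyGradient_le hFi z₀.fn ht.1.le (by
        have : ∀ᵐ s ∂(timeMeasure T),
            inner ℝ (penaltyGradient (z₀.fn + ∫ r in (0 : ℝ)..s, F r)) (F s) ≤ 0 := by
          filter_upwards [hF, hFx, h.z_neumann] with s h1 h2 h3
          rw [← h1]
          exact inner_penaltyGradient_nonpos hU hUb hε hφ h3 h2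
        filter_upwards [(ae_restrict_iff' measurableSet_Ioo).1 this] with s hs hst
        exact hs ⟨hst.1, hst.2.trans_lt ht.2⟩)
    rw [penaltyFunctional_eq_zero_iff.2 hz₀] at key
    exact penaltyFunctional_eq_zero_iff.1 (key.antisymm (penaltyFunctional_nonneg _))

theorem intervalIntegral_congr_timeMeasure {T : ℝ} {p q : ℝ → ℝ}
    (h : ∀ᵐ s ∂(timeMeasure T), p s = q s) {t : ℝ} (ht : t ∈ Ioo 0 T) :
    ∫ s in (0 : ℝ)..t, p s = ∫ s in (0 : ℝ)..t, q s := by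
  refine intervalIntegral.integral_congr_ae ?_
  filter_upwards [(ae_restrict_iff' measurableSet_Ioo).1 h] with s hs hst
  rw [uIoc_of_le ht.1.le] at hst
  exact hs ⟨hst.1, hst.2.trans_lt ht.2⟩

/-- The coefficients of a weak solution may be changed off the range of `z`. -/
theorem IsWeakSolution.congr {T ε η : ℝ} {a b a' b' : ℝ → ℝ} {g u₀ z₀ : L2 U}
    {u z : ℝ → H1 U} (h : IsWeakSolution U T ε η a b g u₀ z₀ u z)
    (ha : ∀ᵐ t ∂(timeMeasure T), ∀ᵐ x ∂(volume.restrict U),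
      a ((z t).fn x) = a' ((z t).fn x))
    (hb : ∀ᵐ t ∂(timeMeasure T), ∀ᵐ x ∂(volume.restrict U),
      b ((z t).fn x) = b' ((z t).fn x)) :
    IsWeakSolution U T ε η a' b' g u₀ z₀ u z := by
  have hfl : ∀ᵐ t ∂(timeMeasure T), ∀ ξ,
      fluxTerm η a (u t) (z t) ξ =ᵐ[volume.restrict U] fluxTerm η a' (u t) (z t) ξ := by
    filter_upwards [ha] with t ht ξ
    filter_upwards [ht] with x hx
    simp only [fluxTerm, hx]
  have hre : ∀ᵐ t ∂(timeMeasure T), ∀ ξ,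
      reactionTerm b (u t) (z t) ξ =ᵐ[volume.restrict U] reactionTerm b' (u t) (z t) ξ := by
    filter_upwards [hb] with t ht ξ
    filter_upwards [ht] with x hx
    simp only [reactionTerm, hx]
  have hfl' : ∀ ξ, ∀ᵐ t ∂(timeMeasure T), ∫ x in U, fluxTerm η a (u t) (z t) ξ x =
      ∫ x in U, fluxTerm η a' (u t) (z t) ξ x := fun ξ => by
    filter_upwards [hfl] with t ht using integral_congr_ae (ht ξ)
  have hre' : ∀ ξ, ∀ᵐ t ∂(timeMeasure T), ∫ x in U, reactionTerm b (u t) (z t) ξ x =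
      ∫ x in U, reactionTerm b' (u t) (z t) ξ x := fun ξ => by
    filter_upwards [hre] with t ht using integral_congr_ae (ht ξ)
  refine { h with
    integrable_flux := fun ξ hξ => ⟨?_, (h.integrable_flux ξ hξ).2.congr (hfl' ξ)⟩
    integrable_reaction := fun ξ hξ => ⟨?_, (h.integrable_reaction ξ hξ).2.congr (hre' ξ)⟩
    u_equation := ?_
    z_equation := ?_ }
  · filter_upwards [hfl, (h.integrable_flux ξ hξ).1] with t h1 h2 using h2.congr (h1 ξ)
  · filter_upwards [hre, (h.integrable_reaction ξ hξ).1] with t h1 h2 using h2.congr (h1 ξ)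
  · filter_upwards [h.u_equation, ae_restrict_mem measurableSet_Ioo] with t h1 ht ξ hξ
    rw [h1 ξ hξ, intervalIntegral_congr_timeMeasure (hfl' ξ) ht]
  · filter_upwards [h.z_equation, ae_restrict_mem measurableSet_Ioo] with t h1 ht ξ hξ
    rw [h1 ξ hξ, intervalIntegral_congr_timeMeasure (hre' ξ) ht]

end MaximumPrinciple

end AmbrosioTortorelli

end

theorem proposition2p4 (U : Set Plane) (hU : IsBoundedC2Domain U) (T ε η : ℝ) (hT : 0 < T)
    (hε : 0 < ε) (hη : 0 < η) (φ : ℝ → ℝ) (hφ : IsCutoff φ) (g : L2 U) (u₀ z₀ : H1 U)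
    (hz₀ : ∀ᵐ x ∂(volume.restrict U), 0 ≤ z₀.fn x ∧ z₀.fn x ≤ 1)
    (u z : ℝ → H2 U) (h : IsStrongSolutionCutoff φ U T ε η g u₀ z₀ u z) :
    (∃ w : ℝ → L2 U, IsContinuousRepresentative T (fun t => (z t).fn) w ∧
      ∀ t ∈ Ioo 0 T, ∀ᵐ x ∂(volume.restrict U), 0 ≤ w t x ∧ w t x ≤ 1) ∧
    IsStrongSolutionAT U T ε η g u₀ z₀ u z := by
  obtain ⟨w, hw, hw01⟩ :=
    h.exists_continuousRepresentative hU.isOpen hU.isBounded hT hε hφ hz₀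
  refine ⟨⟨w, hw, hw01⟩, ?_⟩
  have hz01 : ∀ᵐ t ∂(timeMeasure T), ∀ᵐ x ∂(volume.restrict U),
      (z t).toH1.fn x ∈ Icc (0 : ℝ) 1 := by
    filter_upwards [hw.2, ae_restrict_mem measurableSet_Ioo] with t h1 ht
    have h2 := hw01 t ht
    rw [h1] at h2
    exact h2
  -- Regularity and the boundary conditions do not involve the coefficients; only the weak
  -- formulation has to be transferred.
  refine ⟨h.isWeakSolution.congr ?_ ?_, h.u_L2_H2, h.z_L2_H2, h.u_linfty_H1, h.z_linfty_H1,
    h.u_H1_L2, h.z_H1_L2, h.u_neumann, h.z_neumann⟩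
  · filter_upwards [hz01] with t ht
    filter_upwards [ht] with x hx
    rw [hφ.eqOn_id hx, id]
  · filter_upwards [hz01] with t ht
    filter_upwards [ht] with x hx
    rw [hφ.eqOn_id hx, hφ.eqOn_deriv hx, id, one_mul]
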